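/- Let $\Bbbk$ be any field, let $I\subseteq \Bbbk[\mathbf x]=\Bbbk[x_1,\dots,x_n]$ be a monomial ideal, and for $\mathbf b\in\mathbb N^n$ let $$K^{\mathbf b}I=\{\tau\subseteq\{1,\dots,n\} : \mathbf x^{\mathbf b-\tau}\in I\}$$ be its (upper) Koszul simplicial complex, where $\tau$ is identified with its characteristic vector. All chains $\widetilde C_i$, cycles $\widetilde Z_i$, boundaries $\widetilde B_i$ and homology groups $\widetilde H_i$ are reduced simplicial ones over $\Bbbk$, with boundary maps $\partial_i:\widetilde C_i\to\widetilde C_{i-1}$; $K_i$ is the set of $i$-faces of $K$, and $(-1)^{\sigma\subset\tau}$ is the coefficient of the facet $\sigma$ in $\partial\tau$. **Hedges and communities.** Let $K$ be a simplicial complex. A *shrubbery* in dimension $i$ is a set $T_i\subseteq K_i$ such that $\partial_i$ restricts to an isomorphism $\Bbbk\{T_i\}\to\widetilde B_{i-1}K$. A *stake set* in dimension $i$ is a set $S_i\subseteq K_i$ such that the coordinate projection $\widetilde C_iK\to\Bbbk\{S_i\}$ restricts to an isomorphism $\widetilde B_iK\to\Bbbk\{S_i\}$. A *hedge* of dimension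 $i$ is a pair $ST_i=(S_{i-1},T_i)$. A *community* in $K$ is a sequence of hedges $ST_0,ST_1,ST_2,\dots$ with $T_i\cap S_i=\varnothing$ for all $i$. (The shrubbery $T_{-1}$ is always the empty set of faces.) Given these data: * the *circuit* of $\sigma\in K_i$ is the unique cycle $z\in\widetilde Z_iK$ with $\sigma-z\in\Bbbk\{T_i\}$; write $c_\sigma(\sigma',T_i)$ for its coefficient on $\sigma'$; * the *shrub* of a stake $\sigma\in S_{i-1}$ is the unique chain $s\in\Bbbk\{T_i\}$ whose boundary has coefficient $1$ on $\sigma$ and $0$ on all other stakes in $S_{i-1}$; write $c_\sigma(\tau,ST_i)$ for its coefficient on $\tau$; * the *hedge rim* of $\rho\in K_i$ is the unique chain $r\in\Bbbk\{K_i\setminus S_i\}$ with $\rho-r\in\widetilde B_iK$; write $c_\rho(\rho',S_i)$ for its coefficient on $\rho'$. **Fences.** Fix a community in $K^{\mathbf c}I$ for every $\mathbf c\in\mathbb N^n$, with stake sets $S^{\mathbf c}_i$ and shrubberies $T^{\mathbf c}_i$. Let $\mathbf a\prec\mathbf b$ in $\mathbb N^n$ (that is, $\mathbf a\le\mathbf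 b$ coordinatewise and $\mathbf a\ne\mathbf b$), and let $\Lambda(\mathbf a,\mathbf b)$ be the set of saturated decreasing lattice paths $\lambda:\mathbf b=\mathbf b_0,\mathbf b_1,\dots,\mathbf b_\ell=\mathbf a$, whose steps $\lambda_j=\mathbf b_{j-1}-\mathbf b_j$ are standard basis vectors. Let $i\ge 0$, $\tau\in K^{\mathbf b}_iI$ and $\sigma\in K^{\mathbf a}_{i-1}I$. A *chain-link fence* $\phi$ from $\tau$ to $\sigma$ along $\lambda$, subordinate to the given communities, consists of faces $\tau_j\in K_i^{\mathbf b_j}I$ $(0\le j\le\ell-1)$ and $\sigma_j\in K_{i-1}^{\mathbf b_j}I$ $(1\le j\le \ell)$ such that * $c_\tau(\tau_0,S_i^{\mathbf b})\neq0$; * $\sigma_j=\tau_{j-1}-\lambda_j$ is a facet of $\tau_{j-1}$ for $1\le j\le\ell$; * $\sigma_j\in S_{i-1}^{\mathbf b_j}$ and $c_{\sigma_j}(\tau_j,ST_i^{\mathbf b_j})\ne0$ for $1\le j\le\ell-1$; * $c_{\sigma_\ell}(\sigma,T_{i-1}^{\mathbf a})\ne0$. Its *simple weight* is $$w_\phi^\Bbbk=c_\tau(\tau_0,S_i^{\mathbf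 b})\cdot\prod_{j=1}^{\ell-1}c_{\sigma_j}(\tau_j,ST_i^{\mathbf b_j})\cdot\prod_{j=1}^{\ell}(-1)^{\sigma_j\subset\tau_{j-1}}\cdot c_{\sigma_\ell}(\sigma,T_{i-1}^{\mathbf a}).$$ The *sylvan homomorphism* $D=D^{\mathbf a\mathbf b}:\widetilde C_iK^{\mathbf b}I\to\widetilde C_{i-1}K^{\mathbf a}I$ is given by the matrix whose entry $D_{\sigma\tau}$ is the sum of the simple weights $w^\Bbbk_\phi$ of all these fences from $\tau$ to $\sigma$ along all $\lambda\in\Lambda(\mathbf a,\mathbf b)$. **Claim.** For all $\mathbf a\prec\mathbf b$ and $i\ge0$, the sylvan homomorphism $D^{\mathbf a\mathbf b}$ maps $\widetilde Z_iK^{\mathbf b}I$ into $\widetilde Z_{i-1}K^{\mathbf a}I$ and vanishes on $\widetilde B_iK^{\mathbf b}I$; hence it induces a well-defined *sylvan homology morphism* $\widetilde H_iK^{\mathbf b}I\to\widetilde H_{i-1}K^{\mathbf a}I$. The induced homomorphisms of $\mathbb N^n$-graded free $\Bbbk[\mathbf x]$-modules $$\widetilde H_iK^{\mathbf b}I\otimes_\Bbbk\Bbbk[\mathbf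 x](-\mathbf b)\to\widetilde H_{i-1}K^{\mathbf a}I\otimes_\Bbbk\Bbbk[\mathbf x](-\mathbf a)\qquad(\mathbf a\prec\mathbf b)$$ (the homology morphism times $\mathbf x^{\mathbf b-\mathbf a}$) are the components of the differentials of a minimal $\mathbb N^n$-graded free resolution of $I$ whose module in homological stage $i$ is $\bigoplus_{\mathbf b\in\mathbb N^n}\widetilde H_{i-1}K^{\mathbf b}I\otimes_\Bbbk\Bbbk[\mathbf x](-\mathbf b)$. -/

import Mathlib

open scoped TensorProduct DirectSum

namespace Sylvan

/-! ### Chains on subcomplexes of the simplex with vertex set `{0, …, n - 1}`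

A simplicial complex is a lower set of finite sets.  It may be void, and `∅` is a face of every
complex that is not void.  Faces and chains are indexed by the cardinality `k` of the faces, so
index `k` stands for dimension `k - 1`. -/

section Chains

variable (𝕜 : Type*) [Field 𝕜] {n : ℕ}

/-- All chains on the full simplex; the faces form the standard basis. -/
abbrev Chain (n : ℕ) : Type _ := Finset (Fin n) → 𝕜

/-- The span of a set `T` of faces: the chains whose coefficients outside of `T` vanish. -/
def facesSpan (T : Set (Finset (Fin n))) : Submodule 𝕜 (Chain 𝕜 n) where
  carrier := {c | ∀ τ, τ ∉ T → c τ = 0}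
  add_mem' hc hc' τ hτ := by simp [hc τ hτ, hc' τ hτ]
  zero_mem' _ _ := rfl
  smul_mem' t c hc τ hτ := by simp [hc τ hτ]

variable {𝕜} in
theorem single_mem_facesSpan {T : Set (Finset (Fin n))} {σ : Finset (Fin n)} (hσ : σ ∈ T) :
    (Pi.single σ 1 : Chain 𝕜 n) ∈ facesSpan 𝕜 T :=
  fun _ hτ => Pi.single_eq_of_ne (fun h => hτ (by rwa [h])) 1

variable {𝕜} in
theorem facesSpan_mono {T T' : Set (Finset (Fin n))} (h : T ⊆ T') :
    facesSpan 𝕜 T ≤ facesSpan 𝕜 T' :=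
  fun _ hc τ hτ => hc τ fun h' => hτ (h h')

/-- The sign of the facet `τ \ {v}` in the boundary of `τ`: `(-1) ^ j` if `v` is the `j`-th
vertex of `τ` in increasing order, starting with `j = 0`. -/
def facetSign (v : Fin n) (τ : Finset (Fin n)) : 𝕜 := (-1) ^ (τ.filter (· < v)).card

/-- The reduced simplicial boundary map. -/
noncomputable def boundary : Chain 𝕜 n →ₗ[𝕜] Chain 𝕜 n :=
  Fintype.linearCombination 𝕜 fun τ : Finset (Fin n) =>
    ∑ v ∈ τ, facetSign 𝕜 v τ • (Pi.single (τ.erase v) 1 : Chain 𝕜 n)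

/-- The faces of `K` with `k` vertices, that is, of dimension `k - 1`. -/
def faces (K : LowerSet (Finset (Fin n))) (k : ℕ) : Set (Finset (Fin n)) :=
  {τ | τ ∈ K ∧ τ.card = k}

/-- The reduced chains of `K` in dimension `k - 1`. -/
noncomputable def chains (K : LowerSet (Finset (Fin n))) (k : ℕ) : Submodule 𝕜 (Chain 𝕜 n) :=
  facesSpan 𝕜 (faces K k)

/-- The reduced cycles of `K` in dimension `k - 1`. -/
noncomputable def cycles (K : LowerSet (Finset (Fin n))) (k : ℕ) : Submodule 𝕜 (Chain 𝕜 n) :=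
  chains 𝕜 K k ⊓ LinearMap.ker (boundary 𝕜)

/-- The reduced boundaries of `K` in dimension `k - 1`. -/
noncomputable def boundaries (K : LowerSet (Finset (Fin n))) (k : ℕ) :
    Submodule 𝕜 (Chain 𝕜 n) :=
  (chains 𝕜 K (k + 1)).map (boundary 𝕜)

variable {𝕜} in
theorem boundaries_le_chains (K : LowerSet (Finset (Fin n))) (k : ℕ) :
    boundaries 𝕜 K k ≤ chains 𝕜 K k := by
  rintro _ ⟨c, hc, rfl⟩
  rw [boundary, Fintype.linearCombination_apply]
  refine Submodule.sum_mem _ fun τ _ => ?_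
  by_cases hτ : τ ∈ faces K (k + 1)
  · refine Submodule.smul_mem _ _ (Submodule.sum_mem _ fun v hv => Submodule.smul_mem _ _ ?_)
    refine single_mem_facesSpan ⟨K.lower (Finset.erase_subset v τ) hτ.1, ?_⟩
    rw [Finset.card_erase_of_mem hv, hτ.2, Nat.add_sub_cancel]
  · rw [hc τ hτ, zero_smul]
    exact Submodule.zero_mem _

/-- The reduced homology of `K` in dimension `k - 1`. -/
abbrev Homology (K : LowerSet (Finset (Fin n))) (k : ℕ) : Type _ :=
  cycles 𝕜 K k ⧸ (boundaries 𝕜 K k).submoduleOf (cycles 𝕜 K k)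

/-- `T` is a shrubbery of `K` in dimension `k - 1`: a set of `(k - 1)`-faces such that the boundary
map is an isomorphism from the span of `T` to the boundary of the whole chain space. -/
def IsShrubbery (K : LowerSet (Finset (Fin n))) (k : ℕ) (T : Set (Finset (Fin n))) : Prop :=
  T ⊆ faces K k ∧
    Set.BijOn (boundary 𝕜 (n := n)) (facesSpan 𝕜 T)
      ((chains 𝕜 K k).map (boundary 𝕜))

/-- `S` is a stake set of `K` in dimension `k - 1`: a set of `(k - 1)`-faces such that restricting
coefficients to `S` is an isomorphism from the space of `(k - 1)`-boundaries to `𝕜 ^ S`. -/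
def IsStakeSet (K : LowerSet (Finset (Fin n))) (k : ℕ) (S : Set (Finset (Fin n))) : Prop :=
  S ⊆ faces K k ∧
    Function.Bijective fun (β : boundaries 𝕜 K k) (σ : S) => (β : Chain 𝕜 n) σ

/-- A community in `K`: in every dimension `i ≥ 0` a hedge, consisting of a stake set
`stakes i` in dimension `i - 1` and a shrubbery `shrubs (i + 1)` in dimension `i`, such that in each
dimension the shrubbery and the stake set are disjoint.  For uniformity the shrubbery `shrubs 0` in
dimension `-1` is part of the data; it is forced to be the empty set of faces. -/
structure Community (K : LowerSet (Finset (Fin n))) where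
  stakes : ℕ → Set (Finset (Fin n))
  shrubs : ℕ → Set (Finset (Fin n))
  isStakeSet : ∀ k, IsStakeSet 𝕜 K k (stakes k)
  isShrubbery : ∀ k, IsShrubbery 𝕜 K k (shrubs k)
  disjoint : ∀ k, Disjoint (shrubs k) (stakes k)

end Chains

section Links

variable {𝕜 : Type*} [Field 𝕜] {n : ℕ}

/-- The unique chain with the property `P` (and `0` if there is no such unique chain). -/
noncomputable def theChain (P : Chain 𝕜 n → Prop) : Chain 𝕜 n :=
  open Classical in if h : ∃! c, P c then h.choose else 0

theorem theChain_spec {P : Chain 𝕜 n → Prop} (h : ∃! c, P c) : P (theChain P) := by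
  classical
  rw [theChain, dif_pos h]
  exact h.choose_spec.1

variable {K : LowerSet (Finset (Fin n))} (𝒞 : Community 𝕜 K)

/-- `z` is the circuit of the `(k - 1)`-face `σ`: a cycle that differs from `σ` by a chain on the
shrubbery in dimension `k - 1`. -/
def IsCircuit (k : ℕ) (σ : Finset (Fin n)) (z : Chain 𝕜 n) : Prop :=
  z ∈ cycles 𝕜 K k ∧ Pi.single σ 1 - z ∈ facesSpan 𝕜 (𝒞.shrubs k)

/-- `s` is the shrub of the stake `σ` of dimension `k - 1`: a chain on the shrubbery in dimension
`k` whose boundary has coefficient `1` on `σ` and `0` on all other stakes. -/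
def IsShrub (k : ℕ) (σ : Finset (Fin n)) (s : Chain 𝕜 n) : Prop :=
  s ∈ facesSpan 𝕜 (𝒞.shrubs (k + 1)) ∧
    boundary 𝕜 s σ = 1 ∧ ∀ σ' ∈ 𝒞.stakes k, σ' ≠ σ → boundary 𝕜 s σ' = 0

/-- `r` is the hedge rim of the `(k - 1)`-face `ρ`: a chain on the non-stakes of dimension
`k - 1` that differs from `ρ` by a boundary. -/
def IsHedgeRim (k : ℕ) (ρ : Finset (Fin n)) (r : Chain 𝕜 n) : Prop :=
  r ∈ facesSpan 𝕜 (faces K k \ 𝒞.stakes k) ∧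
    Pi.single ρ 1 - r ∈ boundaries 𝕜 K k

theorem existsUnique_isCircuit {k : ℕ} {σ : Finset (Fin n)} (hσ : σ ∈ faces K k) :
    ∃! z, IsCircuit 𝒞 k σ z := by
  obtain ⟨hT, hmap, hinj, hsurj⟩ := 𝒞.isShrubbery k
  have hσc : (Pi.single σ 1 : Chain 𝕜 n) ∈ chains 𝕜 K k := single_mem_facesSpan hσ
  obtain ⟨t, ht, hts⟩ := hsurj ⟨_, hσc, rfl⟩
  refine ⟨Pi.single σ 1 - t, ⟨⟨?_, ?_⟩, ?_⟩, ?_⟩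
  · exact Submodule.sub_mem _ hσc (facesSpan_mono hT ht)
  · simp [hts]
  · simpa using ht
  · rintro z ⟨⟨-, hz⟩, hzt⟩
    have : Pi.single σ 1 - z = t := hinj hzt ht (by
      rw [map_sub, hts, LinearMap.mem_ker.1 hz, sub_zero])
    rw [← this, sub_sub_cancel]

theorem existsUnique_isShrub {k : ℕ} {σ : Finset (Fin n)} (hσ : σ ∈ 𝒞.stakes k) :
    ∃! s, IsShrub 𝒞 k σ s := by
  classical
  obtain ⟨hT, hmap, hinj, hsurj⟩ := 𝒞.isShrubbery (k + 1)
  obtain ⟨hS, hinj', hsurj'⟩ := 𝒞.isStakeSet k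
  obtain ⟨⟨β, hβ⟩, hβσ⟩ := hsurj' fun σ' => if (σ' : Finset (Fin n)) = σ then 1 else 0
  obtain ⟨s, hs, rfl⟩ := hsurj hβ
  refine ⟨s, ⟨hs, by simpa using congrFun hβσ ⟨σ, hσ⟩, fun σ' h' hne => ?_⟩, ?_⟩
  · simpa [hne] using congrFun hβσ ⟨σ', h'⟩
  · rintro s' ⟨hs', h1, h0⟩
    refine hinj hs' hs ?_
    have := @hinj' ⟨_, hmap hs'⟩ ⟨_, hβ⟩ (by
      rw [hβσ]
      funext ⟨σ', h'⟩
      by_cases h : σ' = σ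
      · subst h; simpa using h1
      · simpa [h] using h0 σ' h' h)
    exact congrArg Subtype.val this

theorem existsUnique_isHedgeRim {k : ℕ} {ρ : Finset (Fin n)} (hρ : ρ ∈ faces K k) :
    ∃! r, IsHedgeRim 𝒞 k ρ r := by
  obtain ⟨hS, hinj, hsurj⟩ := 𝒞.isStakeSet k
  obtain ⟨⟨β, hβ⟩, hβσ⟩ := hsurj fun σ' => ((Pi.single ρ 1 : Chain 𝕜 n)) σ'
  have hρc : (Pi.single ρ 1 : Chain 𝕜 n) ∈ chains 𝕜 K k := single_mem_facesSpan hρ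
  refine ⟨Pi.single ρ 1 - β, ⟨?_, by simpa using hβ⟩, ?_⟩
  · intro τ hτ
    by_cases hτS : τ ∈ 𝒞.stakes k
    · have := congrFun hβσ ⟨τ, hτS⟩
      simp only at this
      simp [this]
    · have hτK : τ ∉ faces K k := fun h => hτ ⟨h, hτS⟩
      exact (Submodule.sub_mem _ hρc (boundaries_le_chains K k hβ)) τ hτK
  · rintro r ⟨hr, hrB⟩
    have hβr := @hinj ⟨_, hrB⟩ ⟨_, hβ⟩ (by
      rw [hβσ]
      funext ⟨σ', h'⟩
      have : r σ' = 0 := hr σ' fun h => h.2 h'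
      simp [this])
    have hβr' : Pi.single ρ 1 - r = β := congrArg Subtype.val hβr
    rw [← hβr', sub_sub_cancel]

/-- The coefficient of `σ'` in the circuit of the `(k - 1)`-face `σ`. -/
noncomputable def circuitCoeff (k : ℕ) (σ σ' : Finset (Fin n)) : 𝕜 :=
  theChain (IsCircuit 𝒞 k σ) σ'

/-- The coefficient of `τ` in the shrub of the `(k - 1)`-stake `σ`. -/
noncomputable def shrubCoeff (k : ℕ) (σ τ : Finset (Fin n)) : 𝕜 :=
  theChain (IsShrub 𝒞 k σ) τ

/-- The coefficient of `ρ'` in the hedge rim of the `(k - 1)`-face `ρ`. -/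
noncomputable def rimCoeff (k : ℕ) (ρ ρ' : Finset (Fin n)) : 𝕜 :=
  theChain (IsHedgeRim 𝒞 k ρ) ρ'

end Links

section Koszul

variable {𝕜 : Type*} [Field 𝕜] {n : ℕ}

/-- A monomial ideal: an ideal generated by monomials. -/
def IsMonomialIdeal (I : Ideal (MvPolynomial (Fin n) 𝕜)) : Prop :=
  ∃ A : Set (Fin n →₀ ℕ), I = Ideal.span ((fun e => MvPolynomial.monomial e (1 : 𝕜)) '' A)

/-- The characteristic vector of a finite set. -/
noncomputable def charVec (τ : Finset (Fin n)) : Fin n →₀ ℕ := ∑ v ∈ τ, Finsupp.single v 1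

theorem charVec_mono {σ τ : Finset (Fin n)} (h : σ ⊆ τ) : charVec σ ≤ charVec τ :=
  Finset.sum_le_sum_of_subset h

/-- The (upper) Koszul simplicial complex of `I` in degree `b`: all `τ` such that
`x ^ (b - τ)` is a monomial that lies in `I`. -/
noncomputable def koszul (I : Ideal (MvPolynomial (Fin n) 𝕜)) (b : Fin n →₀ ℕ) :
    LowerSet (Finset (Fin n)) where
  carrier := {τ | charVec τ ≤ b ∧ MvPolynomial.monomial (b - charVec τ) (1 : 𝕜) ∈ I}
  lower' := by
    rintro τ σ hστ ⟨hb, hI⟩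
    have h := charVec_mono hστ
    refine ⟨h.trans hb, ?_⟩
    have : b - charVec σ = (charVec τ - charVec σ) + (b - charVec τ) := by
      ext v
      have h1 := h v
      have h2 := hb v
      simp only [Finsupp.coe_tsub, Pi.sub_apply, Finsupp.coe_add, Pi.add_apply]
      omega
    rw [this, ← one_mul (1 : 𝕜), ← MvPolynomial.monomial_mul]
    exact I.mul_mem_left _ hI

end Koszul

/-! ### Lattice paths and chain-link fences

A saturated decreasing lattice path of length `m + 1` from `b` to `a` is given by its sequence of
steps; `p j` is the index of the coordinate direction of the `(j + 1)`-st step. -/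

section Fences

variable {𝕜 : Type*} [Field 𝕜] {n : ℕ}

/-- The saturated decreasing lattice paths of length `m + 1` from `b` to `a`. -/
noncomputable def latticePaths (m : ℕ) (a b : Fin n →₀ ℕ) : Finset (Fin (m + 1) → Fin n) :=
  Finset.univ.filter fun p => a + ∑ j, Finsupp.single (p j) 1 = b

/-- The `j`-th lattice point on the path that starts in `b` and has the steps `p`. -/
noncomputable def node {m : ℕ} (b : Fin n →₀ ℕ) (p : Fin (m + 1) → Fin n) (j : ℕ) : Fin n →₀ ℕ :=
  b - ∑ i with i.val < j, Finsupp.single (p i) 1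

/-- The inner vertices of a fence along a path of length `ℓ = m + 1`:
`upper j` is the `i`-simplex `τ_j` for `0 ≤ j ≤ ℓ - 1`, and
`lower j` is the `(i - 1)`-simplex `σ_{j + 1}`, again for `0 ≤ j ≤ ℓ - 1`. -/
abbrev FenceData (m n : ℕ) : Type :=
  (Fin (m + 1) → Finset (Fin n)) × (Fin (m + 1) → Finset (Fin n))

/-- The simplices `τ_0, …, τ_{ℓ - 1}`. -/
abbrev FenceData.upper {m n : ℕ} (φ : FenceData m n) : Fin (m + 1) → Finset (Fin n) := φ.1

/-- The simplices `σ_1, …, σ_ℓ`. -/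
abbrev FenceData.lower {m n : ℕ} (φ : FenceData m n) : Fin (m + 1) → Finset (Fin n) := φ.2

variable {I : Ideal (MvPolynomial (Fin n) 𝕜)} (𝒞 : ∀ c, Community 𝕜 (koszul I c))

/-- `φ` is a chain-link fence along the path with steps `p` from `b` to `a`, from the
`i`-simplex `τ` to the `(i - 1)`-simplex `σ`, subordinate to the hedgerow cut out of the given
communities.  Here `i` is a dimension, so `i`-simplices have `i + 1` vertices. -/
structure IsFence {m : ℕ} (i : ℕ) (a b : Fin n →₀ ℕ) (p : Fin (m + 1) → Fin n)
    (σ τ : Finset (Fin n)) (φ : FenceData m n) : Prop where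
  initial_mem : τ ∈ faces (koszul I b) (i + 1)
  terminal_mem : σ ∈ faces (koszul I a) i
  upper_mem : ∀ j : Fin (m + 1), φ.upper j ∈ faces (koszul I (node b p j)) (i + 1)
  lower_mem : ∀ j : Fin (m + 1), φ.lower j ∈ faces (koszul I (node b p (j + 1))) i
  /-- `τ` is boundary-linked to `τ_0`. -/
  boundary_link : rimCoeff (𝒞 b) (i + 1) τ (φ.upper 0) ≠ 0
  /-- `σ_j` is the facet `τ_{j - 1} - λ_j` of `τ_{j - 1}`. -/
  facet : ∀ j : Fin (m + 1), p j ∈ φ.upper j ∧ φ.lower j = (φ.upper j).erase (p j)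
  /-- At each interior vertex of the path, `σ_j` is a stake. -/
  stake : ∀ j : Fin m, φ.lower j.castSucc ∈ (𝒞 (node b p (j + 1))).stakes i
  /-- At each interior vertex of the path, the stake `σ_j` is chain-linked to `τ_j`. -/
  chain_link : ∀ j : Fin m,
    shrubCoeff (𝒞 (node b p (j + 1))) i (φ.lower j.castSucc) (φ.upper j.succ) ≠ 0
  /-- `σ_ℓ` is cycle-linked to `σ`. -/
  cycle_link : circuitCoeff (𝒞 a) i (φ.lower (Fin.last m)) σ ≠ 0

/-- The simple weight of a fence: the product of the simple weights of its edges. -/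
noncomputable def simpleWeight {m : ℕ} (i : ℕ) (a b : Fin n →₀ ℕ) (p : Fin (m + 1) → Fin n)
    (σ τ : Finset (Fin n)) (φ : FenceData m n) : 𝕜 :=
  rimCoeff (𝒞 b) (i + 1) τ (φ.upper 0) *
    (∏ j : Fin m,
      shrubCoeff (𝒞 (node b p (j + 1))) i (φ.lower j.castSucc) (φ.upper j.succ)) *
    (∏ j : Fin (m + 1), facetSign 𝕜 (p j) (φ.upper j)) *
    circuitCoeff (𝒞 a) i (φ.lower (Fin.last m)) σ

open Classical in
/-- The entry `D_{σ τ}` of the sylvan matrix: the sum, over all saturated decreasing lattice paths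
from `b` to `a`, of the simple weights of all fences from `τ` to `σ` along the path that are
subordinate to the given hedgerow.  For `a < b` all such paths have length `|b| - |a| ≥ 1`. -/
noncomputable def sylvanEntry (i : ℕ) (a b : Fin n →₀ ℕ) (σ τ : Finset (Fin n)) : 𝕜 :=
  ∑ p ∈ latticePaths (b.degree - a.degree - 1) a b,
    ∑ φ : FenceData (b.degree - a.degree - 1) n with IsFence 𝒞 i a b p σ τ φ,
      simpleWeight 𝒞 i a b p σ τ φ

/-- The sylvan homomorphism from the `i`-chains of `koszul I b` to the `(i - 1)`-chains of
`koszul I a`, with matrix `sylvanEntry`.  (All entries outside of these faces vanish.) -/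
noncomputable def sylvanHom (i : ℕ) (a b : Fin n →₀ ℕ) : Chain 𝕜 n →ₗ[𝕜] Chain 𝕜 n :=
  Fintype.linearCombination 𝕜 fun τ : Finset (Fin n) =>
    ∑ σ : Finset (Fin n), sylvanEntry 𝒞 i a b σ τ • (Pi.single σ 1 : Chain 𝕜 n)

/-- The sylvan homomorphism maps cycles to cycles and vanishes on boundaries. -/
def InducesOnHomology (i : ℕ) (a b : Fin n →₀ ℕ) : Prop :=
  (∀ z ∈ cycles 𝕜 (koszul I b) (i + 1), sylvanHom 𝒞 i a b z ∈ cycles 𝕜 (koszul I a) i) ∧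
    ∀ z ∈ boundaries 𝕜 (koszul I b) (i + 1), sylvanHom 𝒞 i a b z = 0

/-- The sylvan homology morphism. -/
noncomputable def sylvanHomology (i : ℕ) (a b : Fin n →₀ ℕ) (h : InducesOnHomology 𝒞 i a b) :
    Homology 𝕜 (koszul I b) (i + 1) →ₗ[𝕜] Homology 𝕜 (koszul I a) i :=
  Submodule.mapQ _ _ ((sylvanHom 𝒞 i a b).restrict h.1) (by
    intro z hz
    have h0 : (sylvanHom 𝒞 i a b).restrict h.1 z = 0 := Subtype.ext (h.2 z hz)
    rw [Submodule.mem_comap, h0]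
    exact Submodule.zero_mem _)

/-! ### The complex of free modules -/

variable (I) in
/-- The free module in homological stage `i`: the direct sum over all degrees `b` of
`H ⊗ 𝕜[x](-b)`, where `H` is the reduced homology of `koszul I b` in dimension `i - 1`. -/
abbrev SylvanModule (i : ℕ) : Type _ :=
  ⨁ b : Fin n →₀ ℕ, MvPolynomial (Fin n) 𝕜 ⊗[𝕜] Homology 𝕜 (koszul I b) i

variable (I) in
/-- The component of `SylvanModule I i` in degree `c`; the element `x ^ e ⊗ h` of the summand
indexed by `b` has degree `e + b`. -/
noncomputable def sylvanPiece (i : ℕ) (c : Fin n →₀ ℕ) : Submodule 𝕜 (SylvanModule I i) :=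
  Submodule.span 𝕜 {x | ∃ (e b : Fin n →₀ ℕ) (h : Homology 𝕜 (koszul I b) i), e + b = c ∧
    x = DirectSum.lof (MvPolynomial (Fin n) 𝕜) (Fin n →₀ ℕ)
      (fun b => MvPolynomial (Fin n) 𝕜 ⊗[𝕜] Homology 𝕜 (koszul I b) i) b
      (MvPolynomial.monomial e 1 ⊗ₜ h)}

/-- The homomorphism from stage `i + 1` to stage `i` whose component from the summand of `b` to the
summand of `a < b` is `x ^ (b - a)` times the sylvan homology morphism. -/
noncomputable def sylvanDifferential
    (h : ∀ a b : Fin n →₀ ℕ, a < b → ∀ i, InducesOnHomology 𝒞 i a b) (i : ℕ) :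
    SylvanModule I (i + 1) →ₗ[MvPolynomial (Fin n) 𝕜] SylvanModule I i :=
  DirectSum.toModule (MvPolynomial (Fin n) 𝕜) (Fin n →₀ ℕ) (SylvanModule I i) fun b =>
    ∑ a ∈ (Finset.Iio b).attach,
      DirectSum.lof (MvPolynomial (Fin n) 𝕜) (Fin n →₀ ℕ)
        (fun a => MvPolynomial (Fin n) 𝕜 ⊗[𝕜] Homology 𝕜 (koszul I a) i) a.1 ∘ₗ
        ((MvPolynomial.monomial (b - a.1) (1 : 𝕜)) •
          (sylvanHomology 𝒞 i a.1 b (h a.1 b (Finset.mem_Iio.1 a.2) i)).baseChange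
            (MvPolynomial (Fin n) 𝕜))

end Fences

/-- The homomorphisms `d` make the modules `F 0, F 1, F 2, …` with the gradings `𝒜` a minimal
`ℕ ^ n`-graded free resolution of the ideal `I`. -/
structure IsMinimalFreeResolution {𝕜 : Type*} [Field 𝕜] {n : ℕ}
    (I : Ideal (MvPolynomial (Fin n) 𝕜)) (F : ℕ → Type*) [∀ i, AddCommGroup (F i)]
    [∀ i, Module (MvPolynomial (Fin n) 𝕜) (F i)] [∀ i, Module 𝕜 (F i)]
    [∀ i, IsScalarTower 𝕜 (MvPolynomial (Fin n) 𝕜) (F i)]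
    (𝒜 : ∀ i, (Fin n →₀ ℕ) → Submodule 𝕜 (F i))
    (d : ∀ i, F (i + 1) →ₗ[MvPolynomial (Fin n) 𝕜] F i) : Prop where
  /-- Each `F i` is a graded free module of finite rank. -/
  graded_free : ∀ i, ∃ (r : ℕ) (B : Module.Basis (Fin r) (MvPolynomial (Fin n) 𝕜) (F i))
    (deg : Fin r → (Fin n →₀ ℕ)), ∀ c, 𝒜 i c = Submodule.span 𝕜
      {x | ∃ (e : Fin n →₀ ℕ) (j : Fin r), e + deg j = c ∧
        x = MvPolynomial.monomial e (1 : 𝕜) • B j}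
  /-- The differentials preserve degrees. -/
  homogeneous : ∀ i c, ∀ x ∈ 𝒜 (i + 1) c, d i x ∈ 𝒜 i c
  /-- The complex is exact in all positive homological stages. -/
  exact : ∀ i, Function.Exact (d (i + 1)) (d i)
  /-- The cokernel of the last map is isomorphic to `I`, as a graded module. -/
  augmentation : ∃ ε : F 0 →ₗ[MvPolynomial (Fin n) 𝕜] I,
    Function.Surjective ε ∧ Function.Exact (d 0) ε ∧
      ∀ c, ∀ x ∈ 𝒜 0 c, ∃ t : 𝕜, (ε x : MvPolynomial (Fin n) 𝕜) = MvPolynomial.monomial c t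
  /-- Minimality: the differentials vanish modulo the maximal ideal `(x_1, …, x_n)`. -/
  minimal : ∀ i, LinearMap.range (d i) ≤
    Ideal.span (Set.range (MvPolynomial.X : Fin n → MvPolynomial (Fin n) 𝕜)) •
      (⊤ : Submodule (MvPolynomial (Fin n) 𝕜) (F i))

end Sylvan

namespace Sylvan

/-! The strand of degree `c` of the Koszul resolution consists of families of chains indexed by the
degrees `b ≤ c`. Its differential is `d - p`, where `d` is the simplicial boundary in each degree
and `p` removes a vertex `v` while lowering the degree by `v`. Strands are exact in positive
positions because vertices can be swept, one coordinate at a time, up to degree `c`.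

A community provides a splitting of each simplicial boundary: the shrub map `h`, which sends a
stake to its shrub and other faces to `0`, satisfies `d h d = d`, `h d h = h` and `h ^ 2 = 0`. Hence
every homology class has exactly one harmonic representative, that is, a cycle killed by `h`; the
projection onto harmonic chains is `π = 1 - d h - h d`. Homological perturbation transfers the
differential of the strand to the harmonic chains, where it becomes `π p (1 - h p)⁻¹` without losing
exactness. In the geometric series `∑ (h p) ^ m` each factor `p` descends one step of a lattice
path, so the matrix entries of the transferred differential are the sums over chain-link fences
that define the sylvan matrix. -/

/-! ### The boundary as a sum over vertices -/

section Vertices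

variable {𝕜 : Type*} [Field 𝕜] {n : ℕ}

/-- The part of the boundary map that deletes the vertex `v`. -/
def removeVertex (v : Fin n) : Chain 𝕜 n →ₗ[𝕜] Chain 𝕜 n where
  toFun x σ := if v ∈ σ then 0 else facetSign 𝕜 v σ * x (insert v σ)
  map_add' x y := by ext σ; by_cases h : v ∈ σ <;> simp [h, mul_add]
  map_smul' t x := by ext σ; by_cases h : v ∈ σ <;> simp [h, mul_left_comm]

/-- The signed insertion of the vertex `v`: the cone operator adjoint to `removeVertex v`. -/
def addVertex (v : Fin n) : Chain 𝕜 n →ₗ[𝕜] Chain 𝕜 n where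
  toFun x τ := if v ∈ τ then facetSign 𝕜 v τ * x (τ.erase v) else 0
  map_add' x y := by ext σ; by_cases h : v ∈ σ <;> simp [h, mul_add]
  map_smul' t x := by ext σ; by_cases h : v ∈ σ <;> simp [h, mul_left_comm]

theorem removeVertex_apply (v : Fin n) (x : Chain 𝕜 n) (σ : Finset (Fin n)) :
    removeVertex v x σ = if v ∈ σ then 0 else facetSign 𝕜 v σ * x (insert v σ) := rfl

theorem addVertex_apply (v : Fin n) (x : Chain 𝕜 n) (τ : Finset (Fin n)) :
    addVertex v x τ = if v ∈ τ then facetSign 𝕜 v τ * x (τ.erase v) else 0 := rfl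

theorem facetSign_mul_self (v : Fin n) (τ : Finset (Fin n)) :
    facetSign 𝕜 v τ * facetSign 𝕜 v τ = 1 := by
  rw [facetSign, ← pow_add, ← two_mul, pow_mul]
  simp

theorem facetSign_insert_self (v : Fin n) (τ : Finset (Fin n)) :
    facetSign 𝕜 v (insert v τ) = facetSign 𝕜 v τ := by
  simp [facetSign, Finset.filter_insert]

theorem facetSign_erase_self (v : Fin n) (τ : Finset (Fin n)) :
    facetSign 𝕜 v (τ.erase v) = facetSign 𝕜 v τ := by
  rw [← facetSign_insert_self v (τ.erase v)]
  by_cases h : v ∈ τ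
  · rw [Finset.insert_erase h]
  · rw [Finset.erase_eq_of_notMem h, facetSign_insert_self]

theorem facetSign_insert {v w : Fin n} {τ : Finset (Fin n)} (hw : w ∉ τ) :
    facetSign 𝕜 v (insert w τ) = (if w < v then -1 else 1) * facetSign 𝕜 v τ := by
  by_cases h : w < v
  · rw [facetSign, Finset.filter_insert, if_pos h, Finset.card_insert_of_notMem (by simp [hw]),
      pow_succ, if_pos h, facetSign, mul_comm]
  · rw [facetSign, Finset.filter_insert, if_neg h, if_neg h, one_mul, facetSign]

theorem removeVertex_removeVertex (v w : Fin n) (x : Chain 𝕜 n) :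
    removeVertex v (removeVertex w x) + removeVertex w (removeVertex v x) = 0 := by
  ext σ
  simp only [Pi.add_apply, removeVertex_apply, Finset.mem_insert, Pi.zero_apply]
  by_cases hv : v ∈ σ
  · simp [hv]
  by_cases hw : w ∈ σ
  · simp [hw]
  by_cases hvw : v = w
  · simp [hvw]
  rw [if_neg hv, if_neg hw, if_neg (by tauto), if_neg (by tauto), facetSign_insert hv,
    facetSign_insert hw, Finset.insert_comm]
  rcases lt_or_gt_of_ne hvw with h | h
  · rw [if_pos h, if_neg h.not_gt]; ring
  · rw [if_pos h, if_neg h.not_gt]; ring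

theorem removeVertex_removeVertex_self (v : Fin n) (x : Chain 𝕜 n) :
    removeVertex v (removeVertex v x) = 0 := by
  ext σ
  simp [removeVertex_apply]

theorem removeVertex_addVertex {v w : Fin n} (hvw : v ≠ w) (x : Chain 𝕜 n) :
    removeVertex v (addVertex w x) + addVertex w (removeVertex v x) = 0 := by
  ext σ
  simp only [Pi.add_apply, removeVertex_apply, addVertex_apply, Finset.mem_insert, Pi.zero_apply,
    Finset.mem_erase]
  by_cases hv : v ∈ σ
  · simp [hv, hvw]
  by_cases hw : w ∈ σ
  · rw [if_neg hv, if_pos hw, if_pos (Or.inr hw), if_neg (not_and_of_not_right _ hv)]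
    obtain ⟨ρ, hρ, rfl⟩ : ∃ ρ, w ∉ ρ ∧ insert w ρ = σ :=
      ⟨σ.erase w, by simp, Finset.insert_erase hw⟩
    have hvρ : v ∉ ρ := fun h => hv (Finset.mem_insert_of_mem h)
    rw [Finset.insert_comm, facetSign_insert hρ, Finset.erase_insert (by simp [hρ, Ne.symm hvw]),
      Finset.erase_insert hρ, facetSign_insert_self, facetSign_insert_self,
      facetSign_insert hvρ]
    rcases lt_or_gt_of_ne hvw with h | h
    · rw [if_pos h, if_neg h.not_gt]; ring
    · rw [if_pos h, if_neg h.not_gt]; ring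
  · simp [hw, Ne.symm hvw]

theorem removeVertex_addVertex_self (v : Fin n) (x : Chain 𝕜 n) (σ : Finset (Fin n)) :
    removeVertex v (addVertex v x) σ = if v ∈ σ then 0 else x σ := by
  by_cases h : v ∈ σ
  · simp [removeVertex_apply, h]
  · simp [removeVertex_apply, addVertex_apply, h, facetSign_insert_self, ← mul_assoc,
      facetSign_mul_self]

theorem addVertex_removeVertex_self (v : Fin n) (x : Chain 𝕜 n) (σ : Finset (Fin n)) :
    addVertex v (removeVertex v x) σ = if v ∈ σ then x σ else 0 := by
  by_cases h : v ∈ σ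
  · simp [removeVertex_apply, addVertex_apply, h, facetSign_erase_self, ← mul_assoc,
      facetSign_mul_self]
  · simp [addVertex_apply, h]

theorem removeVertex_single (v : Fin n) (τ : Finset (Fin n)) :
    removeVertex v (Pi.single τ 1 : Chain 𝕜 n) =
      if v ∈ τ then facetSign 𝕜 v τ • (Pi.single (τ.erase v) 1 : Chain 𝕜 n) else 0 := by
  ext σ
  rw [removeVertex_apply]
  by_cases hσ : v ∈ σ
  · have : σ ≠ τ.erase v := fun h => by simp [h] at hσ
    by_cases hτ : v ∈ τ <;> simp [hσ, hτ, this]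
  · by_cases hτ : v ∈ τ
    · rw [if_neg hσ, if_pos hτ]
      by_cases h : σ = τ.erase v
      · subst h
        simp [Finset.insert_erase hτ, facetSign_erase_self]
      · have : insert v σ ≠ τ := fun h' => h (by rw [← h', Finset.erase_insert hσ])
        simp [h, this]
    · have : insert v σ ≠ τ := fun h => hτ (by rw [← h]; simp)
      simp [hτ, this]

theorem boundary_single (τ : Finset (Fin n)) :
    boundary 𝕜 (Pi.single τ 1) =
      ∑ v ∈ τ, facetSign 𝕜 v τ • (Pi.single (τ.erase v) 1 : Chain 𝕜 n) := by
  classical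
  rw [boundary, Fintype.linearCombination_apply_single, one_smul]

theorem chain_eq_sum (x : Chain 𝕜 n) : x = ∑ τ, x τ • (Pi.single τ 1 : Chain 𝕜 n) := by
  classical
  exact pi_eq_sum_univ' x

theorem boundary_eq_sum : boundary 𝕜 (n := n) = ∑ v, removeVertex v := by
  refine LinearMap.pi_ext' fun τ => LinearMap.ext_ring ?_
  simp only [LinearMap.comp_apply, LinearMap.single_apply, LinearMap.sum_apply]
  rw [boundary_single]
  simp only [removeVertex_single]
  rw [← Finset.sum_filter]
  simp

theorem boundary_apply_eq_sum (x : Chain 𝕜 n) : boundary 𝕜 x = ∑ v, removeVertex v x := by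
  rw [boundary_eq_sum, LinearMap.sum_apply]

theorem sum_sum_eq_zero_of_antisymm {ι M : Type*} [Fintype ι] [AddCommGroup M] (f : ι → ι → M)
    (h : ∀ v w, f v w + f w v = 0) (h0 : ∀ v, f v v = 0) : ∑ v, ∑ w, f v w = 0 := by
  classical
  rw [← Finset.sum_product']
  refine Finset.sum_involution (fun q _ => (q.2, q.1)) (fun q _ => h _ _) (fun q _ hq heq => hq ?_)
    (fun q _ => by simp) (fun q _ => rfl)
  have : q.2 = q.1 := (Prod.ext_iff.1 heq).1
  rw [this, h0]

theorem boundary_boundary (x : Chain 𝕜 n) : boundary 𝕜 (boundary 𝕜 x) = 0 := by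
  simp only [boundary_apply_eq_sum, map_sum]
  exact sum_sum_eq_zero_of_antisymm _ (fun v w => removeVertex_removeVertex w v x)
    fun v => removeVertex_removeVertex_self v x

theorem eqOn_facesSpan {N : Type*} [AddCommGroup N] [Module 𝕜 N] {T : Set (Finset (Fin n))}
    {f g : Chain 𝕜 n →ₗ[𝕜] N} (h : ∀ τ ∈ T, f (Pi.single τ 1) = g (Pi.single τ 1))
    {x : Chain 𝕜 n} (hx : x ∈ facesSpan 𝕜 T) : f x = g x := by
  rw [chain_eq_sum x, map_sum, map_sum]
  refine Finset.sum_congr rfl fun τ _ => ?_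
  rw [map_smul, map_smul]
  by_cases hτ : τ ∈ T
  · rw [h τ hτ]
  · rw [hx τ hτ, zero_smul, zero_smul]

theorem map_mem_of_facesSpan {N : Type*} [AddCommGroup N] [Module 𝕜 N] {T : Set (Finset (Fin n))}
    {f : Chain 𝕜 n →ₗ[𝕜] N} {P : Submodule 𝕜 N} (h : ∀ τ ∈ T, f (Pi.single τ 1) ∈ P)
    {x : Chain 𝕜 n} (hx : x ∈ facesSpan 𝕜 T) : f x ∈ P := by
  rw [chain_eq_sum x, map_sum]
  refine Submodule.sum_mem _ fun τ _ => ?_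
  rw [map_smul]
  by_cases hτ : τ ∈ T
  · exact P.smul_mem _ (h τ hτ)
  · rw [hx τ hτ, zero_smul]
    exact P.zero_mem

theorem boundary_mem_chains {K : LowerSet (Finset (Fin n))} {k : ℕ} {x : Chain 𝕜 n}
    (hx : x ∈ chains 𝕜 K (k + 1)) : boundary 𝕜 x ∈ chains 𝕜 K k :=
  boundaries_le_chains K k ⟨x, hx, rfl⟩

theorem boundary_mem_boundaries {K : LowerSet (Finset (Fin n))} {k : ℕ} {x : Chain 𝕜 n}
    (hx : x ∈ chains 𝕜 K (k + 1)) : boundary 𝕜 x ∈ boundaries 𝕜 K k :=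
  ⟨x, hx, rfl⟩

theorem removeVertex_eq_zero_of_mem_chains_zero {K : LowerSet (Finset (Fin n))} {x : Chain 𝕜 n}
    (hx : x ∈ chains 𝕜 K 0) (v : Fin n) : removeVertex v x = 0 := by
  ext σ
  rw [removeVertex_apply]
  split_ifs
  · rfl
  · rw [hx _ fun h => by simpa using h.2, mul_zero]
    rfl

theorem boundary_eq_zero_of_mem_chains_zero {K : LowerSet (Finset (Fin n))} {x : Chain 𝕜 n}
    (hx : x ∈ chains 𝕜 K 0) : boundary 𝕜 x = 0 := by
  rw [boundary_apply_eq_sum]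
  exact Finset.sum_eq_zero fun v _ => removeVertex_eq_zero_of_mem_chains_zero hx v

end Vertices

/-! ### The splitting given by a community -/

section Splitting

variable {𝕜 : Type*} [Field 𝕜] {n : ℕ} {K : LowerSet (Finset (Fin n))} (𝒞 : Community 𝕜 K)

theorem theChain_eq_zero {P : Chain 𝕜 n → Prop} (h : ∀ c, ¬ P c) : theChain P = 0 := by
  rw [theChain, dif_neg]
  rintro ⟨c, hc, -⟩
  exact h c hc

theorem theChain_eq {P : Chain 𝕜 n → Prop} (h : ∃! c, P c) {c : Chain 𝕜 n} (hc : P c) :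
    theChain P = c :=
  h.unique (theChain_spec h) hc

/-- The linear map that sends each stake to its shrub, and all other faces to `0`. -/
noncomputable def shrubMap : Chain 𝕜 n →ₗ[𝕜] Chain 𝕜 n :=
  Fintype.linearCombination 𝕜 fun σ : Finset (Fin n) => theChain (IsShrub 𝒞 σ.card σ)

theorem shrubMap_single (σ : Finset (Fin n)) :
    shrubMap 𝒞 (Pi.single σ 1) = theChain (IsShrub 𝒞 σ.card σ) := by
  classical
  rw [shrubMap, Fintype.linearCombination_apply_single, one_smul]

variable {𝒞}

theorem theChain_isShrub_eq_zero {k : ℕ} {σ : Finset (Fin n)} (hσ : σ ∉ 𝒞.stakes k) :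
    theChain (IsShrub 𝒞 k σ) = 0 := by
  refine theChain_eq_zero fun s hs => ?_
  obtain ⟨-, hmap, -, -⟩ := 𝒞.isShrubbery (k + 1)
  obtain ⟨-, hinj, -⟩ := 𝒞.isStakeSet k
  have h0 : (⟨boundary 𝕜 s, hmap hs.1⟩ : boundaries 𝕜 K k) = 0 :=
    hinj (funext fun σ' => hs.2.2 σ' σ'.2 fun h => hσ (h ▸ σ'.2))
  have h1 : boundary 𝕜 s σ = 0 := congrFun (congrArg Subtype.val h0) σ
  exact one_ne_zero (hs.2.1.symm.trans h1)

theorem shrubMap_single_of_notMem {k : ℕ} {σ : Finset (Fin n)} (hk : σ.card = k)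
    (hσ : σ ∉ 𝒞.stakes k) : shrubMap 𝒞 (Pi.single σ 1) = 0 := by
  rw [shrubMap_single, hk, theChain_isShrub_eq_zero hσ]

theorem card_of_mem_stakes {k : ℕ} {σ : Finset (Fin n)} (hσ : σ ∈ 𝒞.stakes k) : σ.card = k :=
  ((𝒞.isStakeSet k).1 hσ).2

theorem isShrub_shrubMap {k : ℕ} {σ : Finset (Fin n)} (hσ : σ ∈ 𝒞.stakes k) :
    IsShrub 𝒞 k σ (shrubMap 𝒞 (Pi.single σ 1)) := by
  rw [shrubMap_single, card_of_mem_stakes hσ]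
  exact theChain_spec (existsUnique_isShrub 𝒞 hσ)

theorem shrubMap_mem {k : ℕ} {x : Chain 𝕜 n} (hx : x ∈ chains 𝕜 K k) :
    shrubMap 𝒞 x ∈ facesSpan 𝕜 (𝒞.shrubs (k + 1)) := by
  refine map_mem_of_facesSpan (fun τ hτ => ?_) hx
  by_cases h : τ ∈ 𝒞.stakes k
  · exact (isShrub_shrubMap h).1
  · rw [shrubMap_single_of_notMem hτ.2 h]
    exact Submodule.zero_mem _

theorem shrubMap_mem_chains {k : ℕ} {x : Chain 𝕜 n} (hx : x ∈ chains 𝕜 K k) :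
    shrubMap 𝒞 x ∈ chains 𝕜 K (k + 1) :=
  facesSpan_mono (𝒞.isShrubbery (k + 1)).1 (shrubMap_mem hx)

theorem shrubMap_boundary_mem {k : ℕ} {x : Chain 𝕜 n} (hx : x ∈ chains 𝕜 K k) :
    shrubMap 𝒞 (boundary 𝕜 x) ∈ facesSpan 𝕜 (𝒞.shrubs k) := by
  cases k with
  | zero =>
    rw [boundary_eq_zero_of_mem_chains_zero hx, map_zero]
    exact Submodule.zero_mem _
  | succ k => exact shrubMap_mem (boundary_mem_chains hx)

theorem boundary_shrubMap_apply {k : ℕ} {x : Chain 𝕜 n} (hx : x ∈ chains 𝕜 K k)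
    {σ : Finset (Fin n)} (hσ : σ ∈ 𝒞.stakes k) : boundary 𝕜 (shrubMap 𝒞 x) σ = x σ := by
  refine eqOn_facesSpan (f := LinearMap.proj σ ∘ₗ boundary 𝕜 ∘ₗ shrubMap 𝒞)
    (g := LinearMap.proj σ) (fun τ hτ => ?_) hx
  simp only [LinearMap.comp_apply, LinearMap.proj_apply]
  by_cases h : τ ∈ 𝒞.stakes k
  · by_cases hστ : σ = τ
    · subst hστ
      rw [(isShrub_shrubMap h).2.1, Pi.single_eq_same]
    · rw [(isShrub_shrubMap h).2.2 σ hσ hστ, Pi.single_eq_of_ne hστ]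
  · have hστ : σ ≠ τ := fun h' => h (h' ▸ hσ)
    rw [shrubMap_single_of_notMem hτ.2 h, Pi.single_eq_of_ne hστ, map_zero, Pi.zero_apply]

theorem boundary_shrubMap {k : ℕ} {β : Chain 𝕜 n} (hβ : β ∈ boundaries 𝕜 K k) :
    boundary 𝕜 (shrubMap 𝒞 β) = β := by
  have hβc := boundaries_le_chains K k hβ
  have := (𝒞.isStakeSet k).2.1 (a₁ := ⟨_, boundary_mem_boundaries (shrubMap_mem_chains hβc)⟩)
    (a₂ := ⟨β, hβ⟩) (funext fun σ => boundary_shrubMap_apply hβc σ.2)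
  exact congrArg Subtype.val this

theorem boundary_shrubMap_boundary {k : ℕ} {x : Chain 𝕜 n} (hx : x ∈ chains 𝕜 K k) :
    boundary 𝕜 (shrubMap 𝒞 (boundary 𝕜 x)) = boundary 𝕜 x := by
  cases k with
  | zero => rw [boundary_eq_zero_of_mem_chains_zero hx, map_zero, map_zero]
  | succ k => exact boundary_shrubMap (boundary_mem_boundaries hx)

theorem shrubMap_boundary_shrubMap {k : ℕ} {x : Chain 𝕜 n} (hx : x ∈ chains 𝕜 K k) :
    shrubMap 𝒞 (boundary 𝕜 (shrubMap 𝒞 x)) = shrubMap 𝒞 x := by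
  have h := shrubMap_mem_chains (𝒞 := 𝒞) hx
  exact (𝒞.isShrubbery (k + 1)).2.2.1 (shrubMap_mem (boundary_mem_chains h)) (shrubMap_mem hx)
    (boundary_shrubMap (boundary_mem_boundaries h))

theorem shrubMap_shrubMap {k : ℕ} {x : Chain 𝕜 n} (hx : x ∈ chains 𝕜 K k) :
    shrubMap 𝒞 (shrubMap 𝒞 x) = 0 := by
  refine eqOn_facesSpan (g := 0) (fun τ hτ => ?_) (shrubMap_mem hx)
  exact shrubMap_single_of_notMem ((𝒞.isShrubbery (k + 1)).1 hτ).2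
    fun h => (𝒞.disjoint (k + 1)).le_bot ⟨hτ, h⟩

variable (𝒞) in
/-- The linear map that sends each face to its hedge rim. -/
noncomputable def rimMap : Chain 𝕜 n →ₗ[𝕜] Chain 𝕜 n :=
  LinearMap.id - boundary 𝕜 ∘ₗ shrubMap 𝒞

variable (𝒞) in
/-- The linear map that sends each face to its circuit. -/
noncomputable def circuitMap : Chain 𝕜 n →ₗ[𝕜] Chain 𝕜 n :=
  LinearMap.id - shrubMap 𝒞 ∘ₗ boundary 𝕜

theorem rimMap_apply (x : Chain 𝕜 n) : rimMap 𝒞 x = x - boundary 𝕜 (shrubMap 𝒞 x) := rfl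

theorem circuitMap_apply (x : Chain 𝕜 n) :
    circuitMap 𝒞 x = x - shrubMap 𝒞 (boundary 𝕜 x) := rfl

theorem rimMap_mem {k : ℕ} {x : Chain 𝕜 n} (hx : x ∈ chains 𝕜 K k) :
    rimMap 𝒞 x ∈ chains 𝕜 K k :=
  Submodule.sub_mem _ hx (boundary_mem_chains (shrubMap_mem_chains hx))

theorem circuitMap_mem_cycles {k : ℕ} {x : Chain 𝕜 n} (hx : x ∈ chains 𝕜 K k) :
    circuitMap 𝒞 x ∈ cycles 𝕜 K k := by
  refine ⟨Submodule.sub_mem _ hx ?_, ?_⟩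
  · exact facesSpan_mono (𝒞.isShrubbery k).1 (shrubMap_boundary_mem hx)
  · rw [SetLike.mem_coe, LinearMap.mem_ker, circuitMap_apply, map_sub,
      boundary_shrubMap_boundary hx, sub_self]

theorem rimMap_eq_zero {k : ℕ} {β : Chain 𝕜 n} (hβ : β ∈ boundaries 𝕜 K k) :
    rimMap 𝒞 β = 0 := by
  rw [rimMap_apply, boundary_shrubMap hβ, sub_self]

theorem rimCoeff_eq {k : ℕ} {ρ : Finset (Fin n)} (hρ : ρ ∈ faces K k) (ρ' : Finset (Fin n)) :
    rimCoeff 𝒞 k ρ ρ' = rimMap 𝒞 (Pi.single ρ 1) ρ' := by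
  have hc : (Pi.single ρ 1 : Chain 𝕜 n) ∈ chains 𝕜 K k := single_mem_facesSpan hρ
  rw [rimCoeff, theChain_eq (existsUnique_isHedgeRim 𝒞 hρ)]
  refine ⟨fun τ hτ => ?_, ?_⟩
  · by_cases h : τ ∈ faces K k
    · have hS : τ ∈ 𝒞.stakes k := by_contra fun h' => hτ ⟨h, h'⟩
      rw [rimMap_apply, Pi.sub_apply, boundary_shrubMap_apply hc hS, sub_self]
    · exact rimMap_mem hc τ h
  · rw [rimMap_apply, sub_sub_cancel]
    exact boundary_mem_boundaries (shrubMap_mem_chains hc)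

theorem circuitCoeff_eq {k : ℕ} {σ : Finset (Fin n)} (hσ : σ ∈ faces K k)
    (σ' : Finset (Fin n)) : circuitCoeff 𝒞 k σ σ' = circuitMap 𝒞 (Pi.single σ 1) σ' := by
  have hc : (Pi.single σ 1 : Chain 𝕜 n) ∈ chains 𝕜 K k := single_mem_facesSpan hσ
  rw [circuitCoeff, theChain_eq (existsUnique_isCircuit 𝒞 hσ)]
  refine ⟨circuitMap_mem_cycles hc, ?_⟩
  rw [circuitMap_apply, sub_sub_cancel]
  exact shrubMap_boundary_mem hc

theorem shrubCoeff_eq {k : ℕ} {σ : Finset (Fin n)} (hσ : σ.card = k) (τ : Finset (Fin n)) :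
    shrubCoeff 𝒞 k σ τ = shrubMap 𝒞 (Pi.single σ 1) τ := by
  rw [shrubMap_single, hσ, shrubCoeff]

theorem mem_faces_of_rimCoeff_ne_zero {k : ℕ} {ρ ρ' : Finset (Fin n)} (hρ : ρ ∈ faces K k)
    (h : rimCoeff 𝒞 k ρ ρ' ≠ 0) : ρ' ∈ faces K k := by
  by_contra h'
  refine h ?_
  rw [rimCoeff_eq hρ]
  exact rimMap_mem (single_mem_facesSpan hρ) _ h'

theorem mem_stakes_of_shrubCoeff_ne_zero {k : ℕ} {σ τ : Finset (Fin n)}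
    (h : shrubCoeff 𝒞 k σ τ ≠ 0) : σ ∈ 𝒞.stakes k := by
  by_contra h'
  exact h (by rw [shrubCoeff, theChain_isShrub_eq_zero h', Pi.zero_apply])

theorem mem_faces_of_shrubCoeff_ne_zero {k : ℕ} {σ τ : Finset (Fin n)}
    (h : shrubCoeff 𝒞 k σ τ ≠ 0) : τ ∈ faces K (k + 1) := by
  have hσ := mem_stakes_of_shrubCoeff_ne_zero h
  by_contra h'
  refine h ((theChain_spec (existsUnique_isShrub 𝒞 hσ)).1 τ fun hτ => h' ?_)
  exact (𝒞.isShrubbery (k + 1)).1 hτ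

theorem source_mem_faces_of_circuitCoeff_ne_zero {k : ℕ} {σ σ' : Finset (Fin n)}
    (h : circuitCoeff 𝒞 k σ σ' ≠ 0) : σ ∈ faces K k := by
  by_contra hσ
  refine h ?_
  rw [circuitCoeff, theChain_eq_zero, Pi.zero_apply]
  rintro z ⟨⟨hz, -⟩, hzt⟩
  have h1 : (Pi.single σ 1 - z : Chain 𝕜 n) σ = 0 := hzt σ fun h' => hσ ((𝒞.isShrubbery k).1 h')
  rw [Pi.sub_apply, hz σ hσ, Pi.single_eq_same, sub_zero] at h1
  exact one_ne_zero h1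

theorem target_mem_faces_of_circuitCoeff_ne_zero {k : ℕ} {σ σ' : Finset (Fin n)}
    (h : circuitCoeff 𝒞 k σ σ' ≠ 0) : σ' ∈ faces K k := by
  by_contra h'
  exact h ((theChain_spec (existsUnique_isCircuit 𝒞
    (source_mem_faces_of_circuitCoeff_ne_zero h))).1.1 _ h')

end Splitting

/-! ### Strands of the Koszul resolution -/

section Strand

variable {𝕜 : Type*} [Field 𝕜] {n : ℕ}

theorem charVec_insert {v : Fin n} {σ : Finset (Fin n)} (hv : v ∉ σ) :
    charVec (insert v σ) = charVec σ + Finsupp.single v 1 := by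
  rw [charVec, Finset.sum_insert hv, add_comm, charVec]

theorem one_le_of_charVec_le {v : Fin n} {τ : Finset (Fin n)} (hv : v ∈ τ) {b : Fin n →₀ ℕ}
    (h : charVec τ ≤ b) : Finsupp.single v 1 ≤ b :=
  le_trans (by
    rw [← Finset.insert_erase hv, charVec_insert (Finset.notMem_erase v τ)]
    exact self_le_add_left _ _) h

theorem mem_koszul {I : Ideal (MvPolynomial (Fin n) 𝕜)} {b : Fin n →₀ ℕ} {τ : Finset (Fin n)} :
    τ ∈ koszul I b ↔ charVec τ ≤ b ∧ MvPolynomial.monomial (b - charVec τ) (1 : 𝕜) ∈ I := Iff.rfl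

theorem insert_mem_koszul_add {I : Ideal (MvPolynomial (Fin n) 𝕜)} {a : Fin n →₀ ℕ} {v : Fin n}
    {σ : Finset (Fin n)} (hv : v ∉ σ) :
    insert v σ ∈ koszul I (a + Finsupp.single v 1) ↔ σ ∈ koszul I a := by
  rw [mem_koszul, mem_koszul, charVec_insert hv, add_le_add_iff_right,
    add_tsub_add_eq_tsub_right]

variable (𝕜 n) in
/-- Families of chains indexed by degrees. -/
abbrev Multichain : Type _ := (Fin n →₀ ℕ) → Chain 𝕜 n

/-- The families whose member of degree `b` is supported on `F b` and vanishes unless `b ≤ c`. -/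
def multispan (F : (Fin n →₀ ℕ) → Set (Finset (Fin n))) (c : Fin n →₀ ℕ) :
    Submodule 𝕜 (Multichain 𝕜 n) where
  carrier := {x | ∀ b, x b ∈ facesSpan 𝕜 (F b) ∧ (¬ b ≤ c → x b = 0)}
  add_mem' hx hy b := ⟨Submodule.add_mem _ (hx b).1 (hy b).1, fun h => by
    rw [Pi.add_apply, (hx b).2 h, (hy b).2 h, add_zero]⟩
  zero_mem' b := ⟨Submodule.zero_mem _, fun _ => rfl⟩
  smul_mem' t x hx b := ⟨Submodule.smul_mem _ _ (hx b).1, fun h => by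
    rw [Pi.smul_apply, (hx b).2 h, smul_zero]⟩

theorem multispan_mono {F F' : (Fin n →₀ ℕ) → Set (Finset (Fin n))} (h : ∀ b, F b ⊆ F' b)
    (c : Fin n →₀ ℕ) : multispan (𝕜 := 𝕜) F c ≤ multispan F' c :=
  fun _ hx b => ⟨facesSpan_mono (h b) (hx b).1, (hx b).2⟩

variable (I : Ideal (MvPolynomial (Fin n) 𝕜)) (c : Fin n →₀ ℕ)

/-- The strand of degree `c` of the Koszul resolution of `I`. -/
abbrev strand : Submodule 𝕜 (Multichain 𝕜 n) := multispan (fun b => {τ | τ ∈ koszul I b}) c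

/-- The part of the strand of degree `c` that is spanned by faces with `k` vertices. -/
abbrev strandPart (k : ℕ) : Submodule 𝕜 (Multichain 𝕜 n) :=
  multispan (fun b => faces (koszul I b) k) c

variable {I c}

theorem strandPart_le_strand (k : ℕ) : strandPart I c k ≤ strand I c :=
  multispan_mono (fun _ _ h => h.1) c

theorem single_mem_multispan {F : (Fin n →₀ ℕ) → Set (Finset (Fin n))} {b : Fin n →₀ ℕ}
    (hb : b ≤ c) {x : Chain 𝕜 n} (hx : x ∈ facesSpan 𝕜 (F b)) :
    (Pi.single b x : Multichain 𝕜 n) ∈ multispan F c := by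
  intro b'
  by_cases h : b' = b
  · subst h
    rw [Pi.single_eq_same]
    exact ⟨hx, fun h => absurd hb h⟩
  · rw [Pi.single_eq_of_ne h]
    exact ⟨Submodule.zero_mem _, fun _ => rfl⟩

/-- Applying a linear map in each degree. -/
def degreewise (f : (Fin n →₀ ℕ) → Chain 𝕜 n →ₗ[𝕜] Chain 𝕜 n) :
    Module.End 𝕜 (Multichain 𝕜 n) :=
  LinearMap.pi fun b => f b ∘ₗ LinearMap.proj b

@[simp]
theorem degreewise_apply (f : (Fin n →₀ ℕ) → Chain 𝕜 n →ₗ[𝕜] Chain 𝕜 n) (x : Multichain 𝕜 n)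
    (b : Fin n →₀ ℕ) : degreewise f x b = f b (x b) := rfl

theorem degreewise_mem {f : (Fin n →₀ ℕ) → Chain 𝕜 n →ₗ[𝕜] Chain 𝕜 n}
    {F F' : (Fin n →₀ ℕ) → Set (Finset (Fin n))}
    (h : ∀ b, ∀ x ∈ facesSpan 𝕜 (F b), f b x ∈ facesSpan 𝕜 (F' b)) {x : Multichain 𝕜 n}
    (hx : x ∈ multispan F c) : degreewise f x ∈ multispan F' c :=
  fun b => ⟨h b _ (hx b).1, fun hb => by rw [degreewise_apply, (hx b).2 hb, map_zero]⟩

variable (𝕜 n) in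
/-- The simplicial boundary in each degree. -/
noncomputable def levelBoundary : Module.End 𝕜 (Multichain 𝕜 n) :=
  degreewise fun _ => boundary 𝕜

variable (𝕜 n) in
/-- The part of the Koszul differential that removes a vertex and decreases the degree by it. -/
noncomputable def descent : Module.End 𝕜 (Multichain 𝕜 n) :=
  LinearMap.pi fun a => ∑ v, removeVertex v ∘ₗ LinearMap.proj (a + Finsupp.single v 1)

theorem levelBoundary_apply (x : Multichain 𝕜 n) (b : Fin n →₀ ℕ) :
    levelBoundary 𝕜 n x b = boundary 𝕜 (x b) := rfl

theorem descent_apply (x : Multichain 𝕜 n) (a : Fin n →₀ ℕ) :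
    descent 𝕜 n x a = ∑ v, removeVertex v (x (a + Finsupp.single v 1)) := by
  simp [descent]

theorem descent_mem {F F' : (Fin n →₀ ℕ) → Set (Finset (Fin n))}
    (h : ∀ a v σ, v ∉ σ → insert v σ ∈ F (a + Finsupp.single v 1) → σ ∈ F' a)
    {x : Multichain 𝕜 n} (hx : x ∈ multispan F c) : descent 𝕜 n x ∈ multispan F' c := by
  refine fun a => ⟨?_, fun ha => ?_⟩
  · rw [descent_apply]
    refine Submodule.sum_mem _ fun v _ σ hσ => ?_
    rw [removeVertex_apply]
    split_ifs with hv
    · rfl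
    · rw [(hx _).1 _ fun h' => hσ (h a v σ hv h'), mul_zero]
  · rw [descent_apply]
    refine Finset.sum_eq_zero fun v _ => ?_
    rw [(hx _).2 fun h' => ha (le_trans (self_le_add_right _ _) h'), map_zero]

theorem descent_mem_strand {x : Multichain 𝕜 n} (hx : x ∈ strand I c) :
    descent 𝕜 n x ∈ strand I c :=
  descent_mem (fun _ _ _ hv => (insert_mem_koszul_add hv).1) hx

theorem descent_mem_strandPart {k : ℕ} {x : Multichain 𝕜 n} (hx : x ∈ strandPart I c (k + 1)) :
    descent 𝕜 n x ∈ strandPart I c k := by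
  refine descent_mem (F' := fun b => faces (koszul I b) k)
    (fun a v σ hv h => ⟨(insert_mem_koszul_add hv).1 h.1, ?_⟩) hx
  have := h.2
  rw [Finset.card_insert_of_notMem hv] at this
  omega

theorem descent_eq_zero {x : Multichain 𝕜 n} (hx : x ∈ strandPart I c 0) :
    descent 𝕜 n x = 0 := by
  ext1 a
  rw [descent_apply]
  exact Finset.sum_eq_zero fun v _ => removeVertex_eq_zero_of_mem_chains_zero (hx _).1 v

theorem boundary_mem_facesSpan (K : LowerSet (Finset (Fin n))) {x : Chain 𝕜 n}
    (hx : x ∈ facesSpan 𝕜 {τ | τ ∈ K}) : boundary 𝕜 x ∈ facesSpan 𝕜 {τ | τ ∈ K} := by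
  rw [boundary_apply_eq_sum]
  refine Submodule.sum_mem _ fun v _ σ hσ => ?_
  rw [removeVertex_apply]
  split_ifs with hv
  · rfl
  · rw [hx _ fun h => hσ (K.lower (Finset.subset_insert _ _) h), mul_zero]

theorem levelBoundary_mem_strand {x : Multichain 𝕜 n} (hx : x ∈ strand I c) :
    levelBoundary 𝕜 n x ∈ strand I c :=
  degreewise_mem (fun b _ h => boundary_mem_facesSpan (koszul I b) h) hx

theorem levelBoundary_mem_strandPart {k : ℕ} {x : Multichain 𝕜 n}
    (hx : x ∈ strandPart I c (k + 1)) : levelBoundary 𝕜 n x ∈ strandPart I c k :=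
  degreewise_mem (fun _ _ => boundary_mem_chains) hx

theorem levelBoundary_eq_zero {x : Multichain 𝕜 n} (hx : x ∈ strandPart I c 0) :
    levelBoundary 𝕜 n x = 0 :=
  funext fun b => boundary_eq_zero_of_mem_chains_zero (hx b).1

theorem levelBoundary_mul_self : levelBoundary 𝕜 n * levelBoundary 𝕜 n = 0 :=
  LinearMap.ext fun x => funext fun b => boundary_boundary (x b)

theorem descent_mul_self : descent 𝕜 n * descent 𝕜 n = 0 := by
  ext1 x
  funext a
  simp only [Module.End.mul_apply, descent_apply, map_sum]
  refine sum_sum_eq_zero_of_antisymm _ (fun v w => ?_) fun v => removeVertex_removeVertex_self v _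
  rw [add_right_comm a]
  exact removeVertex_removeVertex v w _

theorem levelBoundary_descent :
    levelBoundary 𝕜 n * descent 𝕜 n + descent 𝕜 n * levelBoundary 𝕜 n = 0 := by
  ext1 x
  funext a
  simp only [Module.End.mul_apply, descent_apply, map_sum, LinearMap.add_apply, Pi.add_apply,
    levelBoundary_apply, boundary_apply_eq_sum, LinearMap.zero_apply]
  rw [← Finset.sum_add_distrib]
  refine Finset.sum_eq_zero fun v _ => ?_
  rw [← Finset.sum_add_distrib]
  exact Finset.sum_eq_zero fun w _ => removeVertex_removeVertex w v _

variable (𝕜 n) in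
/-- The Koszul differential on the strands. -/
noncomputable def koszulD : Module.End 𝕜 (Multichain 𝕜 n) := levelBoundary 𝕜 n - descent 𝕜 n

theorem koszulD_koszulD (x : Multichain 𝕜 n) : koszulD 𝕜 n (koszulD 𝕜 n x) = 0 := by
  have dd := LinearMap.congr_fun (levelBoundary_mul_self (𝕜 := 𝕜) (n := n)) x
  have pp := LinearMap.congr_fun (descent_mul_self (𝕜 := 𝕜) (n := n)) x
  have dp := LinearMap.congr_fun (levelBoundary_descent (𝕜 := 𝕜) (n := n)) x
  simp only [Module.End.mul_apply, LinearMap.add_apply, LinearMap.zero_apply] at dd pp dp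
  rw [koszulD, LinearMap.sub_apply, LinearMap.sub_apply, map_sub, map_sub, dd, pp,
    eq_neg_of_add_eq_zero_left dp]
  abel

theorem koszulD_mem_strandPart {k : ℕ} {x : Multichain 𝕜 n}
    (hx : x ∈ strandPart I c (k + 1)) : koszulD 𝕜 n x ∈ strandPart I c k :=
  Submodule.sub_mem _ (levelBoundary_mem_strandPart hx) (descent_mem_strandPart hx)

end Strand

/-! ### Exactness of the strands -/

section StrandExactness

variable {𝕜 : Type*} [Field 𝕜] {n : ℕ} {I : Ideal (MvPolynomial (Fin n) 𝕜)} {c : Fin n →₀ ℕ}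

variable (𝕜) in
/-- The part of the Koszul differential that removes the vertex `v`. -/
noncomputable def removeDiff (v : Fin n) : Module.End 𝕜 (Multichain 𝕜 n) :=
  LinearMap.pi fun b =>
    removeVertex v ∘ₗ LinearMap.proj b - removeVertex v ∘ₗ LinearMap.proj (b + Finsupp.single v 1)

theorem removeDiff_apply (v : Fin n) (x : Multichain 𝕜 n) (b : Fin n →₀ ℕ) :
    removeDiff 𝕜 v x b = removeVertex v (x b - x (b + Finsupp.single v 1)) := by
  rw [map_sub]
  rfl

theorem koszulD_eq_sum_removeDiff (x : Multichain 𝕜 n) :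
    koszulD 𝕜 n x = ∑ v, removeDiff 𝕜 v x := by
  funext b
  simp only [koszulD, LinearMap.sub_apply, Pi.sub_apply, levelBoundary_apply, descent_apply,
    boundary_apply_eq_sum, Finset.sum_apply, removeDiff_apply, map_sub, Finset.sum_sub_distrib]

variable (𝕜 c) in
/-- The homotopy that adds the vertex `w` and increases the coordinate at `w` by all possible
positive amounts, without exceeding that of `c`. -/
noncomputable def sweep (w : Fin n) : Module.End 𝕜 (Multichain 𝕜 n) :=
  LinearMap.pi fun b => if b w ≤ c w then
    addVertex w ∘ₗ ∑ t ∈ Finset.range (b w), LinearMap.proj (b.update w t) else 0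

variable (c) in
/-- The sums along the lines in direction `w`, placed at the ends of these lines on which the
coordinate at `w` is that of `c`. -/
noncomputable def collapse (w : Fin n) (x : Multichain 𝕜 n) : Multichain 𝕜 n := fun b σ =>
  if w ∉ σ ∧ b w = c w then ∑ t ∈ Finset.range (b w + 1), x (b.update w t) σ else 0

theorem sweep_apply (w : Fin n) (x : Multichain 𝕜 n) (b : Fin n →₀ ℕ) :
    sweep 𝕜 c w x b =
      if b w ≤ c w then addVertex w (∑ t ∈ Finset.range (b w), x (b.update w t)) else 0 := by
  simp only [sweep, LinearMap.pi_apply]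
  split_ifs <;> simp

theorem update_add_single_self (b : Fin n →₀ ℕ) (w : Fin n) (s t : ℕ) :
    (b + Finsupp.single w s).update w t = b.update w t := by
  ext u
  by_cases hu : u = w <;> simp [Finsupp.update_apply, hu]

theorem update_add_single_of_ne (b : Fin n →₀ ℕ) {v w : Fin n} (h : v ≠ w) (s t : ℕ) :
    (b + Finsupp.single v s).update w t = b.update w t + Finsupp.single v s := by
  ext u
  by_cases hu : u = w
  · simp [hu, Finsupp.single_eq_of_ne h.symm]
  · simp [Finsupp.update_apply, hu]

theorem apply_update_eq_zero {F : (Fin n →₀ ℕ) → Set (Finset (Fin n))} {x : Multichain 𝕜 n}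
    (hx : x ∈ multispan F c) {b : Fin n →₀ ℕ} (hb : ¬ b ≤ c) {w : Fin n} (hw : b w ≤ c w) (t : ℕ) :
    x (b.update w t) = 0 := by
  refine (hx _).2 fun h => hb fun v => ?_
  by_cases hv : v = w
  · rwa [hv]
  · simpa [Finsupp.update_apply, hv] using h v

theorem koszul_mono {b b' : Fin n →₀ ℕ} (h : b ≤ b') : koszul I b ≤ koszul I b' := by
  rintro τ ⟨hb, hI⟩
  refine ⟨hb.trans h, ?_⟩
  have heq : b' - charVec τ = (b' - b) + (b - charVec τ) := (tsub_add_tsub_cancel h hb).symm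
  rw [heq, ← one_mul (1 : 𝕜), ← MvPolynomial.monomial_mul]
  exact I.mul_mem_left _ hI

theorem sweep_mem_strandPart {k : ℕ} {x : Multichain 𝕜 n} (hx : x ∈ strandPart I c k)
    (w : Fin n) : sweep 𝕜 c w x ∈ strandPart I c (k + 1) := by
  refine fun b => ⟨fun τ hτ => ?_, fun hb => ?_⟩ <;> rw [sweep_apply] <;> split_ifs with hw
  · rw [addVertex_apply, Finset.sum_apply]
    split_ifs with hwτ
    · rw [Finset.sum_eq_zero, mul_zero]
      refine fun t ht => (hx _).1 _ fun h => hτ ⟨?_, ?_⟩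
      · have hle : b.update w t + Finsupp.single w 1 ≤ b := fun u => by
          by_cases hu : u = w
          · simpa [hu] using Finset.mem_range.1 ht
          · simp [hu]
        rw [← Finset.insert_erase hwτ]
        exact koszul_mono hle ((insert_mem_koszul_add (Finset.notMem_erase w τ)).2 h.1)
      · rw [← h.2, Finset.card_erase_add_one hwτ]
    · rfl
  · rfl
  · rw [Finset.sum_eq_zero fun t _ => apply_update_eq_zero hx hb hw t, map_zero]
  · rfl

theorem removeDiff_sweep {v w : Fin n} (h : v ≠ w) (x : Multichain 𝕜 n) :
    removeDiff 𝕜 v (sweep 𝕜 c w x) + sweep 𝕜 c w (removeDiff 𝕜 v x) = 0 := by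
  funext b
  have hb : (b + Finsupp.single v 1 : Fin n →₀ ℕ) w = b w := by
    simp [Finsupp.single_eq_of_ne h.symm]
  simp only [Pi.add_apply, removeDiff_apply, sweep_apply, hb, update_add_single_of_ne b h]
  split_ifs
  · rw [← map_sub, ← Finset.sum_sub_distrib, ← map_sum]
    exact removeVertex_addVertex h _
  · simp

theorem sum_removeDiff_update (w : Fin n) (x : Multichain 𝕜 n) (b : Fin n →₀ ℕ) :
    ∑ t ∈ Finset.range (b w), removeDiff 𝕜 w x (b.update w t) =
      removeVertex w (x (b.update w 0) - x b) := by
  have hstep (t : ℕ) : b.update w t + Finsupp.single w 1 = b.update w (t + 1) := by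
    ext u
    by_cases hu : u = w <;> simp [Finsupp.update_apply, hu]
  simp only [removeDiff_apply, hstep]
  rw [← map_sum, Finset.sum_range_sub' fun t => x (b.update w t), Finsupp.update_self]

theorem removeDiff_sweep_self {k : ℕ} {x : Multichain 𝕜 n} (hx : x ∈ strandPart I c k)
    (w : Fin n) :
    removeDiff 𝕜 w (sweep 𝕜 c w x) + sweep 𝕜 c w (removeDiff 𝕜 w x) = collapse c w x - x := by
  ext b σ
  have hlast : ∑ t ∈ Finset.range (b w + 1), x (b.update w t) σ =
      ∑ t ∈ Finset.range (b w), x (b.update w t) σ + x b σ := by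
    rw [Finset.sum_range_succ, Finsupp.update_self]
  have hzero (h : w ∈ σ) : x (b.update w 0) σ = 0 := (hx _).1 σ fun h' => by
    simpa using one_le_of_charVec_le h h'.1.1 w
  have hb : (b + Finsupp.single w 1 : Fin n →₀ ℕ) w = b w + 1 := by simp
  simp only [Pi.add_apply, Pi.sub_apply, removeDiff_apply w (sweep 𝕜 c w x), sweep_apply,
    sum_removeDiff_update, hb, update_add_single_self, collapse, hlast]
  rcases lt_trichotomy (b w) (c w) with hlt | heq | hgt
  · rw [if_pos hlt.le, if_pos (Nat.succ_le_of_lt hlt), if_pos hlt.le, ← map_sub,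
      Finset.sum_range_succ, Finsupp.update_self, sub_add_cancel_left]
    by_cases hσ : w ∈ σ <;>
      simp [hσ, hzero, hlt.ne, removeVertex_addVertex_self, addVertex_removeVertex_self]
  · rw [if_pos heq.le, if_neg (by omega), if_pos heq.le, sub_zero]
    by_cases hσ : w ∈ σ <;>
      simp [hσ, hzero, heq, removeVertex_addVertex_self, addVertex_removeVertex_self,
        -map_sum, -map_sub]
  · rw [(hx b).2 fun h => hgt.not_ge (h w), if_neg hgt.not_ge, if_neg (by omega),
      if_neg hgt.not_ge]
    simp [hgt.ne']

theorem koszulD_sweep {k : ℕ} {x : Multichain 𝕜 n} (hx : x ∈ strandPart I c k) (w : Fin n) :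
    koszulD 𝕜 n (sweep 𝕜 c w x) + sweep 𝕜 c w (koszulD 𝕜 n x) = collapse c w x - x := by
  rw [koszulD_eq_sum_removeDiff, koszulD_eq_sum_removeDiff, map_sum, ← Finset.sum_add_distrib,
    Finset.sum_eq_single w (fun v _ hv => removeDiff_sweep hv x) (by simp),
    removeDiff_sweep_self hx]

theorem koszulD_sweep_of_cycle {k : ℕ} {x : Multichain 𝕜 n} (hx : x ∈ strandPart I c k)
    (hd : koszulD 𝕜 n x = 0) (w : Fin n) :
    koszulD 𝕜 n (sweep 𝕜 c w x) = collapse c w x - x := by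
  rw [← koszulD_sweep hx w, hd, map_zero, add_zero]

theorem exists_ne_zero_of_collapse_ne_zero {w : Fin n} {x : Multichain 𝕜 n} {b : Fin n →₀ ℕ}
    {σ : Finset (Fin n)} (h : collapse c w x b σ ≠ 0) :
    (w ∉ σ ∧ b w = c w) ∧ ∃ t, x (b.update w t) σ ≠ 0 := by
  rw [collapse, ite_ne_right_iff] at h
  obtain ⟨t, -, ht⟩ := Finset.exists_ne_zero_of_sum_ne_zero h.2
  exact ⟨h.1, t, ht⟩

theorem exists_homologous_supported {k : ℕ} {x : Multichain 𝕜 n} (hx : x ∈ strandPart I c k)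
    (hd : koszulD 𝕜 n x = 0) (W : Finset (Fin n)) :
    ∃ z ∈ strandPart I c (k + 1),
      ∀ b σ, (x + koszulD 𝕜 n z) b σ ≠ 0 → ∀ v ∈ W, v ∉ σ ∧ b v = c v := by
  induction W using Finset.induction_on with
  | empty => exact ⟨0, Submodule.zero_mem _, by simp⟩
  | insert w W _ ih =>
    obtain ⟨z, hz, hs⟩ := ih
    set y := x + koszulD 𝕜 n z with hy
    have hy_mem : y ∈ strandPart I c k := Submodule.add_mem _ hx (koszulD_mem_strandPart hz)
    have hyd : koszulD 𝕜 n y = 0 := by rw [hy, map_add, hd, koszulD_koszulD, add_zero]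
    refine ⟨z + sweep 𝕜 c w y, Submodule.add_mem _ hz (sweep_mem_strandPart hy_mem w), ?_⟩
    rw [map_add, koszulD_sweep_of_cycle hy_mem hyd, ← add_assoc, ← hy, add_sub_cancel]
    intro b σ h v hv
    obtain ⟨hw, t, ht⟩ := exists_ne_zero_of_collapse_ne_zero h
    by_cases hvw : v = w
    · rwa [hvw]
    · simpa [Finsupp.update_apply, hvw] using
        hs _ σ ht v ((Finset.mem_insert.1 hv).resolve_left hvw)

variable (𝕜 c) in
/-- The augmentation of the strand of degree `c`: the sum of the coefficients of the empty face. -/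
noncomputable def strandAugmentation : Multichain 𝕜 n →ₗ[𝕜] 𝕜 :=
  ∑ b ∈ Finset.Iic c, LinearMap.proj ∅ ∘ₗ LinearMap.proj b

theorem strandAugmentation_apply (x : Multichain 𝕜 n) :
    strandAugmentation 𝕜 c x = ∑ b ∈ Finset.Iic c, x b ∅ := by
  simp [strandAugmentation]

theorem strandAugmentation_removeDiff {x : Multichain 𝕜 n} (hx : x ∈ strand I c) (v : Fin n) :
    strandAugmentation 𝕜 c (removeDiff 𝕜 v x) = 0 := by
  simp only [strandAugmentation_apply, removeDiff_apply, removeVertex_apply, Finset.notMem_empty,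
    if_false, ← Finset.mul_sum, Pi.sub_apply, Finset.sum_sub_distrib]
  refine mul_eq_zero_of_right _ (sub_eq_zero.2 (Eq.symm ?_))
  refine Finset.sum_bij_ne_zero (fun a _ _ => a + Finsupp.single v 1) (fun a _ h => ?_)
    (fun a _ _ a' _ _ h => add_right_cancel h) (fun b hb h => ?_) fun _ _ _ => rfl
  · refine Finset.mem_Iic.2 (by_contra fun h' => h ?_)
    rw [(hx _).2 h', Pi.zero_apply]
  · have hv : Finsupp.single v 1 ≤ b := by
      by_contra h'
      exact h ((hx b).1 _ fun h'' => h' (one_le_of_charVec_le (Finset.mem_insert_self v ∅) h''.1))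
    refine ⟨b - Finsupp.single v 1, ?_, ?_, tsub_add_cancel_of_le hv⟩
    · exact Finset.mem_Iic.2 (le_trans tsub_le_self (Finset.mem_Iic.1 hb))
    · rwa [tsub_add_cancel_of_le hv]

theorem strandAugmentation_koszulD {x : Multichain 𝕜 n} (hx : x ∈ strand I c) :
    strandAugmentation 𝕜 c (koszulD 𝕜 n x) = 0 := by
  rw [koszulD_eq_sum_removeDiff, map_sum]
  exact Finset.sum_eq_zero fun v _ => strandAugmentation_removeDiff hx v

theorem strand_exact {k : ℕ} {x : Multichain 𝕜 n} (hx : x ∈ strandPart I c k)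
    (hd : koszulD 𝕜 n x = 0) (hε : k = 0 → strandAugmentation 𝕜 c x = 0) :
    ∃ z ∈ strandPart I c (k + 1), koszulD 𝕜 n z = x := by
  obtain ⟨z, hz, hs⟩ := exists_homologous_supported hx hd Finset.univ
  set y := x + koszulD 𝕜 n z with hy
  have corner (b : Fin n →₀ ℕ) (σ : Finset (Fin n)) (h : y b σ ≠ 0) : b = c ∧ σ = ∅ :=
    ⟨Finsupp.ext fun v => (hs b σ h v (Finset.mem_univ v)).2,
      Finset.eq_empty_of_forall_notMem fun v => (hs b σ h v (Finset.mem_univ v)).1⟩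
  have corner_eq_zero : y c ∅ = 0 := by
    by_cases hk : k = 0
    · have hεy : strandAugmentation 𝕜 c y = 0 := by
        rw [hy, map_add, hε hk, strandAugmentation_koszulD (strandPart_le_strand _ hz), add_zero]
      rwa [strandAugmentation_apply, Finset.sum_eq_single c _ (by simp)] at hεy
      exact fun b _ hb => by_contra fun h => hb (corner b ∅ h).1
    · have hy_mem : y ∈ strandPart I c k := Submodule.add_mem _ hx (koszulD_mem_strandPart hz)
      exact (hy_mem c).1 ∅ fun h => hk h.2.symm
  have hy_zero : y = 0 := by
    ext b σ
    by_contra h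
    obtain ⟨rfl, rfl⟩ := corner b σ h
    exact h corner_eq_zero
  refine ⟨-z, Submodule.neg_mem _ hz, ?_⟩
  rw [map_neg, neg_eq_iff_add_eq_zero, add_comm, ← hy, hy_zero]

end StrandExactness

/-! ### Homological perturbation -/

section Perturbation

variable {R : Type*} [Ring R]

/-- The hypotheses of the homological perturbation lemma: `h` splits the differential `d` up to
homotopy, `p` is a perturbation of `d`, and `A` is the inverse of `1 - h * p`. -/
structure IsPerturbedSplitting (d p h A : R) : Prop where
  d_mul_d : d * d = 0
  p_mul_p : p * p = 0
  d_mul_p : d * p + p * d = 0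
  h_mul_h : h * h = 0
  d_mul_h_mul_d : d * h * d = d
  h_mul_d_mul_h : h * d * h = h
  sub_mul_inv : (1 - h * p) * A = 1
  inv_mul_sub : A * (1 - h * p) = 1

/-- The idempotent onto the harmonic part of a differential `d` that is split by `h`. -/
def harmonicIdempotent (d h : R) : R := 1 - d * h - h * d

/-- The differential that a perturbation induces on the harmonic part. -/
def transferredDifferential (d p h A : R) : R :=
  harmonicIdempotent d h * p * A * harmonicIdempotent d h

namespace IsPerturbedSplitting

variable {d p h A : R} (s : IsPerturbedSplitting d p h A)

local notation "π" => harmonicIdempotent d h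
local notation "T" => transferredDifferential d p h A

include s

theorem harmonicIdempotent_mul_self : π * π = π := by
  rw [harmonicIdempotent]
  linear_combination (norm := noncomm_ring) s.d_mul_h_mul_d * h + d * s.h_mul_h * d +
    h * s.d_mul_d * h + s.h_mul_d_mul_h * d

theorem d_mul_harmonicIdempotent : d * π = 0 := by
  rw [harmonicIdempotent]
  linear_combination (norm := noncomm_ring) -s.d_mul_d * h - s.d_mul_h_mul_d

theorem harmonicIdempotent_mul_d : π * d = 0 := by
  rw [harmonicIdempotent]
  linear_combination (norm := noncomm_ring) -s.d_mul_h_mul_d - h * s.d_mul_d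

theorem h_mul_harmonicIdempotent : h * π = 0 := by
  rw [harmonicIdempotent]
  linear_combination (norm := noncomm_ring) -s.h_mul_d_mul_h - s.h_mul_h * d

theorem harmonicIdempotent_mul_h : π * h = 0 := by
  rw [harmonicIdempotent]
  linear_combination (norm := noncomm_ring) -d * s.h_mul_h - s.h_mul_d_mul_h

theorem perturbed_mul_inclusion : (d - p) * (A * π) = -(A * T) := by
  have intertwine : (1 - h * p) * (d - p) = d * (1 - h * p) - π * p := by
    rw [harmonicIdempotent]
    linear_combination (norm := noncomm_ring) h * s.p_mul_p - h * s.d_mul_p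
  rw [transferredDifferential]
  linear_combination (norm := noncomm_ring) A * intertwine * A * π +
    A * d * s.sub_mul_inv * π + A * s.d_mul_harmonicIdempotent -
    s.inv_mul_sub * (d - p) * A * π

theorem projection_mul_perturbed :
    π * (1 + p * A * h) * (d - p) = -(T * (π * (1 + p * A * h))) := by
  have intertwine : (d - p) * (1 - p * h) = (1 - p * h) * d - p * π := by
    rw [harmonicIdempotent]
    linear_combination (norm := noncomm_ring) s.p_mul_p * h - s.d_mul_p * h
  have inverse : (1 - p * h) * (1 + p * A * h) = 1 := by
    linear_combination (norm := noncomm_ring) p * s.sub_mul_inv * h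
  have inverse' : (1 + p * A * h) * (1 - p * h) = 1 := by
    linear_combination (norm := noncomm_ring) p * s.inv_mul_sub * h
  have inverse_mul_p : (1 + p * A * h) * p = p * A := by
    linear_combination (norm := noncomm_ring) -p * s.inv_mul_sub
  generalize 1 + p * A * h = B at *
  rw [transferredDifferential]
  linear_combination (norm := noncomm_ring) -π * B * (d - p) * inverse + π * B * intertwine * B +
    π * inverse' * d * B + s.harmonicIdempotent_mul_d * B - π * inverse_mul_p * π * B +
    π * p * A * s.harmonicIdempotent_mul_self * B

theorem h_mul_inv : h * A = h := by
  linear_combination (norm := noncomm_ring) h * s.sub_mul_inv + s.h_mul_h * p * A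

theorem projection_mul_inclusion : π * (1 + p * A * h) * (A * π) = π := by
  linear_combination (norm := noncomm_ring) π * s.sub_mul_inv * π +
    s.harmonicIdempotent_mul_h * p * A * π + π * p * A * s.h_mul_inv * π +
    π * p * A * s.h_mul_harmonicIdempotent + s.harmonicIdempotent_mul_self

theorem transferredDifferential_mul_self : T * T = 0 := by
  have inclusion_mul : A * π * T = A * T := by
    rw [transferredDifferential]
    linear_combination (norm := noncomm_ring) A * s.harmonicIdempotent_mul_self * p * A * π
  have perturbed_sq : (d - p) * (d - p) = 0 := by
    linear_combination (norm := noncomm_ring) s.d_mul_d - s.d_mul_p + s.p_mul_p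
  have inclusion := s.perturbed_mul_inclusion
  linear_combination (norm := noncomm_ring) -s.sub_mul_inv * T * T + (1 - h * p) *
    (inclusion * T - (d - p) * inclusion_mul - (d - p) * inclusion + perturbed_sq * A * π)

end IsPerturbedSplitting

end Perturbation

/-! ### The transferred differential -/

section Transfer

variable {𝕜 : Type*} [Field 𝕜] {n : ℕ} {I : Ideal (MvPolynomial (Fin n) 𝕜)}
  (𝒞 : ∀ b, Community 𝕜 (koszul I b)) {c : Fin n →₀ ℕ}

/-- The shrub map in each degree. -/
noncomputable def levelShrub : Module.End 𝕜 (Multichain 𝕜 n) := degreewise fun b => shrubMap (𝒞 b)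

variable (c) in
/-- The geometric series of the shrub map after the descent, truncated where its terms vanish on the
strand of degree `c`. -/
noncomputable def resolvent : Module.End 𝕜 (Multichain 𝕜 n) :=
  ∑ m ∈ Finset.range (c.degree + 1), (levelShrub 𝒞 * descent 𝕜 n) ^ m

/-- The projection onto the harmonic families. -/
noncomputable def harmonicProj : Module.End 𝕜 (Multichain 𝕜 n) :=
  harmonicIdempotent (levelBoundary 𝕜 n) (levelShrub 𝒞)

variable (c) in
/-- The differential that the Koszul strand induces on harmonic families. -/
noncomputable def transfer : Module.End 𝕜 (Multichain 𝕜 n) :=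
  harmonicProj 𝒞 * descent 𝕜 n * resolvent 𝒞 c

/-- A family of chains is harmonic if the boundary and the shrub map vanish on it. -/
def IsHarmonic (x : Multichain 𝕜 n) : Prop := levelBoundary 𝕜 n x = 0 ∧ levelShrub 𝒞 x = 0

variable {𝒞}

theorem levelShrub_apply (x : Multichain 𝕜 n) (b : Fin n →₀ ℕ) :
    levelShrub 𝒞 x b = shrubMap (𝒞 b) (x b) := rfl

theorem levelShrub_mem_strandPart {k : ℕ} {x : Multichain 𝕜 n} (hx : x ∈ strandPart I c k) :
    levelShrub 𝒞 x ∈ strandPart I c (k + 1) :=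
  degreewise_mem (fun _ _ => shrubMap_mem_chains) hx

theorem levelShrub_mem_strand {x : Multichain 𝕜 n} (hx : x ∈ strand I c) :
    levelShrub 𝒞 x ∈ strand I c := by
  refine degreewise_mem (F' := fun b => {τ | τ ∈ koszul I b}) (fun b _ h => ?_) hx
  refine map_mem_of_facesSpan (fun τ hτ => ?_) h
  exact facesSpan_mono (fun _ h => h.1)
    (shrubMap_mem_chains (𝒞 := 𝒞 b) (k := τ.card) (single_mem_facesSpan ⟨hτ, rfl⟩))

theorem degreewise_eqOn_strand {f g : (Fin n →₀ ℕ) → Chain 𝕜 n →ₗ[𝕜] Chain 𝕜 n}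
    (h : ∀ b k, ∀ x ∈ chains 𝕜 (koszul I b) k, f b x = g b x) {x : Multichain 𝕜 n}
    (hx : x ∈ strand I c) : degreewise f x = degreewise g x :=
  funext fun b => eqOn_facesSpan (fun τ hτ => h b τ.card _ (single_mem_facesSpan ⟨hτ, rfl⟩))
    (hx b).1

theorem levelShrub_levelShrub {x : Multichain 𝕜 n} (hx : x ∈ strand I c) :
    levelShrub 𝒞 (levelShrub 𝒞 x) = 0 :=
  degreewise_eqOn_strand (f := fun b => shrubMap (𝒞 b) ∘ₗ shrubMap (𝒞 b)) (g := 0)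
    (fun _ _ _ => shrubMap_shrubMap) hx

theorem levelBoundary_levelShrub_levelBoundary {x : Multichain 𝕜 n} (hx : x ∈ strand I c) :
    levelBoundary 𝕜 n (levelShrub 𝒞 (levelBoundary 𝕜 n x)) = levelBoundary 𝕜 n x :=
  degreewise_eqOn_strand (f := fun b => boundary 𝕜 ∘ₗ shrubMap (𝒞 b) ∘ₗ boundary 𝕜)
    (g := fun _ => boundary 𝕜) (fun _ _ _ => boundary_shrubMap_boundary) hx

theorem levelShrub_levelBoundary_levelShrub {x : Multichain 𝕜 n} (hx : x ∈ strand I c) :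
    levelShrub 𝒞 (levelBoundary 𝕜 n (levelShrub 𝒞 x)) = levelShrub 𝒞 x :=
  degreewise_eqOn_strand (f := fun b => shrubMap (𝒞 b) ∘ₗ boundary 𝕜 ∘ₗ shrubMap (𝒞 b))
    (g := fun b => shrubMap (𝒞 b)) (fun _ _ _ => shrubMap_boundary_shrubMap) hx

theorem pow_apply_eq_zero {x : Multichain 𝕜 n} (hx : x ∈ strand I c) (m : ℕ) (a : Fin n →₀ ℕ)
    (ha : c.degree < a.degree + m) : ((levelShrub 𝒞 * descent 𝕜 n) ^ m) x a = 0 := by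
  induction m generalizing a with
  | zero => exact (hx a).2 fun h => by have := Finsupp.degree_mono h; omega
  | succ m ih =>
    rw [pow_succ', Module.End.mul_apply, Module.End.mul_apply, levelShrub_apply, descent_apply,
      Finset.sum_eq_zero, map_zero]
    intro v _
    rw [ih, map_zero]
    rw [map_add, Finsupp.degree_single]
    omega

theorem pow_eq_zero_on_strand {x : Multichain 𝕜 n} (hx : x ∈ strand I c) :
    ((levelShrub 𝒞 * descent 𝕜 n) ^ (c.degree + 1)) x = 0 :=
  funext fun a => pow_apply_eq_zero hx _ a (by omega)

theorem one_sub_mul_resolvent {x : Multichain 𝕜 n} (hx : x ∈ strand I c) :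
    ((1 - levelShrub 𝒞 * descent 𝕜 n) * resolvent 𝒞 c) x = x := by
  rw [resolvent, mul_neg_geom_sum, LinearMap.sub_apply, pow_eq_zero_on_strand hx,
    Module.End.one_apply, sub_zero]

theorem resolvent_mul_one_sub {x : Multichain 𝕜 n} (hx : x ∈ strand I c) :
    (resolvent 𝒞 c * (1 - levelShrub 𝒞 * descent 𝕜 n)) x = x := by
  rw [resolvent, geom_sum_mul_neg, LinearMap.sub_apply, pow_eq_zero_on_strand hx,
    Module.End.one_apply, sub_zero]

theorem pow_mem_strandPart {k : ℕ} {x : Multichain 𝕜 n} (hx : x ∈ strandPart I c k) (m : ℕ) :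
    ((levelShrub 𝒞 * descent 𝕜 n) ^ m) x ∈ strandPart I c k := by
  induction m with
  | zero => exact hx
  | succ m ih =>
    rw [pow_succ', Module.End.mul_apply, Module.End.mul_apply]
    cases k with
    | zero =>
      rw [descent_eq_zero ih, map_zero]
      exact Submodule.zero_mem _
    | succ k => exact levelShrub_mem_strandPart (descent_mem_strandPart ih)

theorem pow_mem_strand {x : Multichain 𝕜 n} (hx : x ∈ strand I c) (m : ℕ) :
    ((levelShrub 𝒞 * descent 𝕜 n) ^ m) x ∈ strand I c := by
  induction m with
  | zero => exact hx
  | succ m ih =>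
    rw [pow_succ', Module.End.mul_apply, Module.End.mul_apply]
    exact levelShrub_mem_strand (descent_mem_strand ih)

theorem resolvent_mem_strandPart {k : ℕ} {x : Multichain 𝕜 n} (hx : x ∈ strandPart I c k) :
    resolvent 𝒞 c x ∈ strandPart I c k := by
  rw [resolvent, LinearMap.sum_apply]
  exact Submodule.sum_mem _ fun m _ => pow_mem_strandPart hx m

theorem resolvent_mem_strand {x : Multichain 𝕜 n} (hx : x ∈ strand I c) :
    resolvent 𝒞 c x ∈ strand I c := by
  rw [resolvent, LinearMap.sum_apply]
  exact Submodule.sum_mem _ fun m _ => pow_mem_strand hx m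

theorem harmonicProj_apply (x : Multichain 𝕜 n) : harmonicProj 𝒞 x =
    x - levelBoundary 𝕜 n (levelShrub 𝒞 x) - levelShrub 𝒞 (levelBoundary 𝕜 n x) := rfl

theorem transfer_apply (x : Multichain 𝕜 n) :
    transfer 𝒞 c x = harmonicProj 𝒞 (descent 𝕜 n (resolvent 𝒞 c x)) := rfl

theorem harmonicProj_mem_strandPart {k : ℕ} {x : Multichain 𝕜 n} (hx : x ∈ strandPart I c k) :
    harmonicProj 𝒞 x ∈ strandPart I c k := by
  rw [harmonicProj_apply]
  refine Submodule.sub_mem _ (Submodule.sub_mem _ hx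
    (levelBoundary_mem_strandPart (levelShrub_mem_strandPart hx))) ?_
  cases k with
  | zero =>
    rw [levelBoundary_eq_zero hx, map_zero]
    exact Submodule.zero_mem _
  | succ k => exact levelShrub_mem_strandPart (levelBoundary_mem_strandPart hx)

theorem transfer_mem_strandPart {k : ℕ} {x : Multichain 𝕜 n} (hx : x ∈ strandPart I c (k + 1)) :
    transfer 𝒞 c x ∈ strandPart I c k := by
  rw [transfer_apply]
  exact harmonicProj_mem_strandPart (descent_mem_strandPart (resolvent_mem_strandPart hx))

theorem harmonicProj_of_isHarmonic {x : Multichain 𝕜 n} (hx : IsHarmonic 𝒞 x) :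
    harmonicProj 𝒞 x = x := by
  rw [harmonicProj_apply, hx.1, hx.2]
  simp

theorem isHarmonic_harmonicProj {x : Multichain 𝕜 n} (hx : x ∈ strand I c) :
    IsHarmonic 𝒞 (harmonicProj 𝒞 x) := by
  have dd : levelBoundary 𝕜 n (levelBoundary 𝕜 n (levelShrub 𝒞 x)) = 0 :=
    LinearMap.congr_fun levelBoundary_mul_self _
  rw [IsHarmonic, harmonicProj_apply]
  constructor
  · rw [map_sub, map_sub, levelBoundary_levelShrub_levelBoundary hx, dd]
    simp
  · rw [map_sub, map_sub, levelShrub_levelBoundary_levelShrub hx,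
      levelShrub_levelShrub (levelBoundary_mem_strand hx)]
    simp

theorem isHarmonic_transfer {x : Multichain 𝕜 n} (hx : x ∈ strand I c) :
    IsHarmonic 𝒞 (transfer 𝒞 c x) :=
  isHarmonic_harmonicProj (descent_mem_strand (resolvent_mem_strand hx))

variable (I c) in
/-- The restriction of `levelBoundary` to a strand. -/
noncomputable def strandBoundary : Module.End 𝕜 (strand I c) :=
  (levelBoundary 𝕜 n).restrict fun _ => levelBoundary_mem_strand

variable (I c) in
/-- The restriction of `descent` to a strand. -/
noncomputable def strandDescent : Module.End 𝕜 (strand I c) :=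
  (descent 𝕜 n).restrict fun _ => descent_mem_strand

variable (𝒞 c) in
/-- The restriction of `levelShrub` to a strand. -/
noncomputable def strandShrub : Module.End 𝕜 (strand I c) :=
  (levelShrub 𝒞).restrict fun _ => levelShrub_mem_strand

variable (𝒞 c) in
/-- The restriction of `resolvent` to a strand. -/
noncomputable def strandResolvent : Module.End 𝕜 (strand I c) :=
  (resolvent 𝒞 c).restrict fun _ => resolvent_mem_strand

variable (𝒞 c) in
theorem isPerturbedSplitting_strand :
    IsPerturbedSplitting (strandBoundary I c) (strandDescent I c) (strandShrub 𝒞 c)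
      (strandResolvent 𝒞 c) where
  d_mul_d := LinearMap.ext fun _ => Subtype.ext (LinearMap.congr_fun levelBoundary_mul_self _)
  p_mul_p := LinearMap.ext fun _ => Subtype.ext (LinearMap.congr_fun descent_mul_self _)
  d_mul_p := LinearMap.ext fun _ => Subtype.ext (LinearMap.congr_fun levelBoundary_descent _)
  h_mul_h := LinearMap.ext fun x => Subtype.ext (levelShrub_levelShrub x.2)
  d_mul_h_mul_d :=
    LinearMap.ext fun x => Subtype.ext (levelBoundary_levelShrub_levelBoundary x.2)
  h_mul_d_mul_h := LinearMap.ext fun x => Subtype.ext (levelShrub_levelBoundary_levelShrub x.2)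
  sub_mul_inv := LinearMap.ext fun x => Subtype.ext (one_sub_mul_resolvent x.2)
  inv_mul_sub := LinearMap.ext fun x => Subtype.ext (resolvent_mul_one_sub x.2)

theorem harmonicIdempotent_strand {x : Multichain 𝕜 n} (hx : x ∈ strand I c)
    (hxh : IsHarmonic 𝒞 x) :
    harmonicIdempotent (strandBoundary I c) (strandShrub 𝒞 c) ⟨x, hx⟩ = ⟨x, hx⟩ :=
  Subtype.ext (harmonicProj_of_isHarmonic hxh)

theorem coe_transferredDifferential_strand {x : Multichain 𝕜 n} (hx : x ∈ strand I c)
    (hxh : IsHarmonic 𝒞 x) :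
    (transferredDifferential (strandBoundary I c) (strandDescent I c) (strandShrub 𝒞 c)
      (strandResolvent 𝒞 c) ⟨x, hx⟩ : Multichain 𝕜 n) = transfer 𝒞 c x := by
  rw [transferredDifferential, Module.End.mul_apply, harmonicIdempotent_strand hx hxh]
  rfl

theorem transfer_transfer {x : Multichain 𝕜 n} (hx : x ∈ strand I c) (hxh : IsHarmonic 𝒞 x) :
    transfer 𝒞 c (transfer 𝒞 c x) = 0 := by
  have key := LinearMap.congr_fun
    (isPerturbedSplitting_strand 𝒞 c).transferredDifferential_mul_self ⟨x, hx⟩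
  rw [← coe_transferredDifferential_strand hx hxh, ← coe_transferredDifferential_strand]
  · exact congrArg Subtype.val key
  · rw [coe_transferredDifferential_strand hx hxh]
    exact isHarmonic_transfer hx

theorem koszulD_resolvent {x : Multichain 𝕜 n} (hx : x ∈ strand I c) (hxh : IsHarmonic 𝒞 x) :
    koszulD 𝕜 n (resolvent 𝒞 c x) = -resolvent 𝒞 c (transfer 𝒞 c x) := by
  have key := congrArg Subtype.val (LinearMap.congr_fun
    (isPerturbedSplitting_strand 𝒞 c).perturbed_mul_inclusion ⟨x, hx⟩)
  rw [Module.End.mul_apply, Module.End.mul_apply, harmonicIdempotent_strand hx hxh] at key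
  rw [← coe_transferredDifferential_strand hx hxh]
  exact key

theorem resolvent_of_mem_strandPart_zero {x : Multichain 𝕜 n} (hx : x ∈ strandPart I c 0) :
    resolvent 𝒞 c x = x := by
  have := resolvent_mul_one_sub (𝒞 := 𝒞) (strandPart_le_strand 0 hx)
  rwa [Module.End.mul_apply, LinearMap.sub_apply, Module.End.mul_apply, descent_eq_zero hx,
    map_zero, sub_zero] at this

theorem strandAugmentation_transfer {x : Multichain 𝕜 n} (hx : x ∈ strandPart I c 1)
    (hxh : IsHarmonic 𝒞 x) : strandAugmentation 𝕜 c (transfer 𝒞 c x) = 0 := by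
  have h1 := koszulD_resolvent (strandPart_le_strand 1 hx) hxh
  rw [resolvent_of_mem_strandPart_zero (transfer_mem_strandPart hx), eq_neg_iff_add_eq_zero,
    add_comm, ← eq_neg_iff_add_eq_zero] at h1
  rw [h1, map_neg, strandAugmentation_koszulD
    (resolvent_mem_strand (strandPart_le_strand 1 hx)), neg_zero]

variable (𝒞 c) in
/-- The left inverse of `resolvent` on harmonic families that is given by perturbation theory. -/
noncomputable def harmonicRetraction : Module.End 𝕜 (Multichain 𝕜 n) :=
  harmonicProj 𝒞 * (1 + descent 𝕜 n * resolvent 𝒞 c * levelShrub 𝒞)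

theorem harmonicRetraction_mem_strandPart {k : ℕ} {z : Multichain 𝕜 n}
    (hz : z ∈ strandPart I c k) : harmonicRetraction 𝒞 c z ∈ strandPart I c k :=
  harmonicProj_mem_strandPart (Submodule.add_mem _ hz (descent_mem_strandPart
    (resolvent_mem_strandPart (levelShrub_mem_strandPart hz))))

theorem isHarmonic_harmonicRetraction {z : Multichain 𝕜 n} (hz : z ∈ strand I c) :
    IsHarmonic 𝒞 (harmonicRetraction 𝒞 c z) :=
  isHarmonic_harmonicProj (Submodule.add_mem _ hz (descent_mem_strand
    (resolvent_mem_strand (levelShrub_mem_strand hz))))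

theorem harmonicRetraction_koszulD {z : Multichain 𝕜 n} (hz : z ∈ strand I c) :
    harmonicRetraction 𝒞 c (koszulD 𝕜 n z) = -transfer 𝒞 c (harmonicRetraction 𝒞 c z) := by
  have key := congrArg Subtype.val (LinearMap.congr_fun
    (isPerturbedSplitting_strand 𝒞 c).projection_mul_perturbed ⟨z, hz⟩)
  rw [← coe_transferredDifferential_strand _ (isHarmonic_harmonicRetraction hz)]
  · exact key

theorem harmonicRetraction_resolvent {x : Multichain 𝕜 n} (hx : x ∈ strand I c)
    (hxh : IsHarmonic 𝒞 x) : harmonicRetraction 𝒞 c (resolvent 𝒞 c x) = x := by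
  have key := congrArg Subtype.val (LinearMap.congr_fun
    (isPerturbedSplitting_strand 𝒞 c).projection_mul_inclusion ⟨x, hx⟩)
  rw [Module.End.mul_apply, Module.End.mul_apply _ (harmonicIdempotent _ _),
    harmonicIdempotent_strand hx hxh] at key
  exact key

theorem transfer_exact {k : ℕ} {x : Multichain 𝕜 n} (hx : x ∈ strandPart I c k)
    (hxh : IsHarmonic 𝒞 x) (h0 : transfer 𝒞 c x = 0)
    (hε : k = 0 → strandAugmentation 𝕜 c x = 0) :
    ∃ w ∈ strandPart I c (k + 1), IsHarmonic 𝒞 w ∧ transfer 𝒞 c w = x := by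
  have hxs := strandPart_le_strand k hx
  obtain ⟨z, hz, hzx⟩ := strand_exact (resolvent_mem_strandPart (𝒞 := 𝒞) hx)
    (by rw [koszulD_resolvent hxs hxh, h0, map_zero, neg_zero]) (by
      rintro rfl
      rw [resolvent_of_mem_strandPart_zero hx, hε rfl])
  have hzs := Submodule.neg_mem _ (strandPart_le_strand _ hz)
  refine ⟨harmonicRetraction 𝒞 c (-z),
    harmonicRetraction_mem_strandPart (Submodule.neg_mem _ hz),
    isHarmonic_harmonicRetraction hzs, ?_⟩
  rw [← neg_neg (transfer 𝒞 c _), ← harmonicRetraction_koszulD hzs, map_neg, map_neg, neg_neg,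
    hzx, harmonicRetraction_resolvent hxs hxh]

end Transfer

/-! ### Fences as lattice walks -/

section Walks

variable {𝕜 : Type*} [Field 𝕜] {n : ℕ}

/-- Alternately removing the vertices `p 0, …, p m` and applying the maps `H 0, …, H (m - 1)`. -/
noncomputable def walk : (m : ℕ) → (Fin m → Chain 𝕜 n →ₗ[𝕜] Chain 𝕜 n) → (Fin (m + 1) → Fin n) →
    Chain 𝕜 n →ₗ[𝕜] Chain 𝕜 n
  | 0, _, p => removeVertex (p 0)
  | m + 1, H, p => removeVertex (p (Fin.last (m + 1))) ∘ₗ H (Fin.last m) ∘ₗ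
      walk m (fun j => H j.castSucc) (fun j => p j.castSucc)

theorem walk_succ (m : ℕ) (H : Fin (m + 1) → Chain 𝕜 n →ₗ[𝕜] Chain 𝕜 n)
    (p : Fin (m + 2) → Fin n) : walk (m + 1) H p = removeVertex (p (Fin.last (m + 1))) ∘ₗ
      H (Fin.last m) ∘ₗ walk m (fun j => H j.castSucc) (fun j => p j.castSucc) := rfl

theorem apply_removeVertex (L : Chain 𝕜 n →ₗ[𝕜] 𝕜) (v : Fin n) (x : Chain 𝕜 n) :
    L (removeVertex v x) =
      ∑ τ, x τ * (if v ∈ τ then facetSign 𝕜 v τ else 0) * L (Pi.single (τ.erase v) 1) := by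
  conv_lhs => rw [chain_eq_sum x, map_sum, map_sum]
  refine Finset.sum_congr rfl fun τ _ => ?_
  rw [map_smul, map_smul, removeVertex_single]
  split_ifs <;> simp [mul_assoc]

theorem apply_walk (m : ℕ) (H : Fin m → Chain 𝕜 n →ₗ[𝕜] Chain 𝕜 n) (p : Fin (m + 1) → Fin n)
    (L : Chain 𝕜 n →ₗ[𝕜] 𝕜) (x : Chain 𝕜 n) :
    L (walk m H p x) = ∑ u : Fin (m + 1) → Finset (Fin n), x (u 0) *
      (∏ j : Fin m, H j (Pi.single ((u j.castSucc).erase (p j.castSucc)) 1) (u j.succ)) *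
      (∏ j, if p j ∈ u j then facetSign 𝕜 (p j) (u j) else 0) *
      L (Pi.single ((u (Fin.last m)).erase (p (Fin.last m))) 1) := by
  induction m generalizing L with
  | zero =>
    rw [walk, apply_removeVertex]
    refine Fintype.sum_equiv (Equiv.funUnique (Fin 1) (Finset (Fin n))).symm _ _ fun τ => ?_
    simp
  | succ m ih =>
    have h := ih (fun j => H j.castSucc) (fun j => p j.castSucc)
      (L ∘ₗ removeVertex (p (Fin.last (m + 1))) ∘ₗ H (Fin.last m))
    simp only [LinearMap.comp_apply] at h
    rw [walk, LinearMap.comp_apply, LinearMap.comp_apply, h]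
    simp only [apply_removeVertex, Finset.mul_sum]
    rw [Finset.sum_comm, ← Finset.sum_product', Finset.univ_product_univ]
    refine Fintype.sum_equiv (Fin.snocEquiv fun _ => Finset (Fin n)) _ _ fun q => ?_
    obtain ⟨t, u⟩ := q
    simp only [Fin.snocEquiv_apply, Fin.prod_univ_castSucc, Fin.snoc_castSucc, Fin.snoc_last,
      Fin.succ_last, ← Fin.castSucc_succ]
    have h0 : (Fin.snoc u t : Fin (m + 2) → Finset (Fin n)) 0 = u 0 :=
      Fin.snoc_castSucc (α := fun _ => Finset (Fin n)) t u 0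
    rw [h0]
    ring

theorem mem_latticePaths {m : ℕ} {a b : Fin n →₀ ℕ} {p : Fin (m + 1) → Fin n} :
    p ∈ latticePaths m a b ↔ a + ∑ j, Finsupp.single (p j) 1 = b := by
  simp [latticePaths]

theorem le_of_mem_latticePaths {m : ℕ} {a b : Fin n →₀ ℕ} {p : Fin (m + 1) → Fin n}
    (h : p ∈ latticePaths m a b) : a ≤ b := by
  rw [← mem_latticePaths.1 h]
  exact self_le_add_right _ _

theorem degree_of_mem_latticePaths {m : ℕ} {a b : Fin n →₀ ℕ} {p : Fin (m + 1) → Fin n}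
    (h : p ∈ latticePaths m a b) : b.degree = a.degree + (m + 1) := by
  rw [← mem_latticePaths.1 h, map_add, map_sum]
  simp

theorem node_zero {m : ℕ} (b : Fin n →₀ ℕ) (p : Fin (m + 1) → Fin n) : node b p 0 = b := by
  simp [node]

theorem node_last {m : ℕ} {a b : Fin n →₀ ℕ} {p : Fin (m + 1) → Fin n}
    (h : p ∈ latticePaths m a b) : node b p (m + 1) = a := by
  rw [node, Finset.filter_true_of_mem fun i _ => i.2, ← mem_latticePaths.1 h,
    add_tsub_cancel_right]

theorem node_eq_node_succ_add {m : ℕ} {a b : Fin n →₀ ℕ} {p : Fin (m + 1) → Fin n}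
    (h : p ∈ latticePaths m a b) (j : Fin (m + 1)) :
    node b p j = node b p (j + 1) + Finsupp.single (p j) 1 := by
  have hfil : (Finset.univ.filter fun i : Fin (m + 1) => i.val < j.val + 1) =
      insert j (Finset.univ.filter fun i : Fin (m + 1) => i.val < j.val) := by
    ext i
    simp only [Finset.mem_filter, Finset.mem_univ, true_and, Finset.mem_insert, Fin.ext_iff]
    omega
  have hle : Finsupp.single (p j) 1 + ∑ i with i.val < j.val, Finsupp.single (p i) 1 ≤ b := by
    rw [← Finset.sum_insert (f := fun i => Finsupp.single (p i) 1) (a := j) (by simp), ← hfil,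
      ← mem_latticePaths.1 h]
    exact le_trans (Finset.sum_le_sum_of_subset (Finset.filter_subset _ _)) (self_le_add_left _ _)
  rw [node, node, hfil, Finset.sum_insert (by simp), add_comm (Finsupp.single (p j) 1), ← tsub_tsub,
    tsub_add_cancel_of_le (le_tsub_of_add_le_right hle)]

theorem node_snoc {m : ℕ} (b : Fin n →₀ ℕ) (p : Fin (m + 1) → Fin n) (v : Fin n) {j : ℕ}
    (hj : j ≤ m + 1) : node b (Fin.snoc p v : Fin (m + 2) → Fin n) j = node b p j := by
  rw [node, node, Finset.sum_filter, Finset.sum_filter, Fin.sum_univ_castSucc]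
  simp [hj.not_gt]

end Walks

section FenceSum

variable {𝕜 : Type*} [Field 𝕜] {n : ℕ} {I : Ideal (MvPolynomial (Fin n) 𝕜)}
  (𝒞 : ∀ b, Community 𝕜 (koszul I b))

/-- The walk along the lattice path `p` that starts in `b`. -/
noncomputable def pathWalk {m : ℕ} (b : Fin n →₀ ℕ) (p : Fin (m + 1) → Fin n) :
    Chain 𝕜 n →ₗ[𝕜] Chain 𝕜 n :=
  walk m (fun j => shrubMap (𝒞 (node b p (j + 1)))) p

/-- The summand of a walk that is contributed by the simplices `u 0, …, u m` above the lattice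
path; it makes sense for arbitrary `u`, and vanishes unless `u` comes from a fence. -/
noncomputable def upperWeight {m : ℕ} (a b : Fin n →₀ ℕ) (p : Fin (m + 1) → Fin n)
    (σ : Finset (Fin n)) (x : Chain 𝕜 n) (u : Fin (m + 1) → Finset (Fin n)) : 𝕜 :=
  x (u 0) *
    (∏ j : Fin m, shrubMap (𝒞 (node b p (j + 1)))
      (Pi.single ((u j.castSucc).erase (p j.castSucc)) 1) (u j.succ)) *
    (∏ j, if p j ∈ u j then facetSign 𝕜 (p j) (u j) else 0) *
    circuitMap (𝒞 a) (Pi.single ((u (Fin.last m)).erase (p (Fin.last m))) 1) σ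

theorem circuitMap_pathWalk {m : ℕ} (a b : Fin n →₀ ℕ) (p : Fin (m + 1) → Fin n) (x : Chain 𝕜 n)
    (σ : Finset (Fin n)) :
    circuitMap (𝒞 a) (pathWalk 𝒞 b p x) σ = ∑ u, upperWeight 𝒞 a b p σ x u :=
  apply_walk m _ p (LinearMap.proj σ ∘ₗ circuitMap (𝒞 a)) x

variable {𝒞} {m i : ℕ} {a b : Fin n →₀ ℕ} {p : Fin (m + 1) → Fin n} {σ τ : Finset (Fin n)}

theorem simpleWeight_eq_upperWeight (hp : p ∈ latticePaths m a b) {φ : FenceData m n}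
    (hφ : IsFence 𝒞 i a b p σ τ φ) :
    simpleWeight 𝒞 i a b p σ τ φ =
      upperWeight 𝒞 a b p σ (rimMap (𝒞 b) (Pi.single τ 1)) φ.upper := by
  have hlast := hφ.lower_mem (Fin.last m)
  rw [Fin.val_last, node_last hp] at hlast
  rw [simpleWeight, upperWeight, rimCoeff_eq hφ.initial_mem, circuitCoeff_eq hlast,
    (hφ.facet (Fin.last m)).2]
  congr 2
  · congr 1
    refine Finset.prod_congr rfl fun j _ => ?_
    rw [shrubCoeff_eq (hφ.lower_mem j.castSucc).2, (hφ.facet j.castSucc).2]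
  · exact Finset.prod_congr rfl fun j _ => by rw [if_pos (hφ.facet j).1]

theorem erase_mem_faces_node_succ (hp : p ∈ latticePaths m a b) {j : Fin (m + 1)}
    {ρ : Finset (Fin n)} (hj : p j ∈ ρ) (hρ : ρ ∈ faces (koszul I (node b p j)) (i + 1)) :
    ρ.erase (p j) ∈ faces (koszul I (node b p (j + 1))) i := by
  refine ⟨?_, by rw [Finset.card_erase_of_mem hj, hρ.2, Nat.add_sub_cancel]⟩
  rw [← insert_mem_koszul_add (Finset.notMem_erase _ _), Finset.insert_erase hj,
    ← node_eq_node_succ_add hp]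
  exact hρ.1

theorem isFence_of_upperWeight_ne_zero (hp : p ∈ latticePaths m a b)
    (hτ : τ ∈ faces (koszul I b) (i + 1)) {u : Fin (m + 1) → Finset (Fin n)}
    (hu : upperWeight 𝒞 a b p σ (rimMap (𝒞 b) (Pi.single τ 1)) u ≠ 0) :
    IsFence 𝒞 i a b p σ τ (u, fun j => (u j).erase (p j)) := by
  simp only [upperWeight, mul_ne_zero_iff, Finset.prod_ne_zero_iff, Finset.mem_univ,
    forall_const] at hu
  obtain ⟨⟨⟨hrim, hshrub⟩, hsign⟩, hcirc⟩ := hu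
  have hmem (j : Fin (m + 1)) : p j ∈ u j := by
    by_contra h
    exact hsign j (if_neg h)
  have hrim' : rimCoeff (𝒞 b) (i + 1) τ (u 0) ≠ 0 := by rwa [rimCoeff_eq hτ]
  have hcoeff (j : Fin m) (hj : (u j.castSucc).card = i + 1) :
      shrubCoeff (𝒞 (node b p (j + 1))) i ((u j.castSucc).erase (p j.castSucc)) (u j.succ) ≠ 0 := by
    rw [shrubCoeff_eq]
    · exact hshrub j
    · rw [Finset.card_erase_of_mem (hmem _), hj, Nat.add_sub_cancel]
  have hupper (j : Fin (m + 1)) : u j ∈ faces (koszul I (node b p j)) (i + 1) := by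
    induction j using Fin.induction with
    | zero =>
      rw [Fin.val_zero, node_zero]
      exact mem_faces_of_rimCoeff_ne_zero hτ hrim'
    | succ j ih => exact mem_faces_of_shrubCoeff_ne_zero (hcoeff j ih.2)
  have hlower (j : Fin (m + 1)) := erase_mem_faces_node_succ hp (hmem j) (hupper j)
  have hlast := hlower (Fin.last m)
  rw [Fin.val_last, node_last hp] at hlast
  have hcirc' : circuitCoeff (𝒞 a) i ((u (Fin.last m)).erase (p (Fin.last m))) σ ≠ 0 := by
    rwa [circuitCoeff_eq hlast]
  exact
    { initial_mem := hτ
      terminal_mem := target_mem_faces_of_circuitCoeff_ne_zero hcirc'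
      upper_mem := hupper
      lower_mem := hlower
      boundary_link := hrim'
      facet := fun j => ⟨hmem j, rfl⟩
      stake := fun j => mem_stakes_of_shrubCoeff_ne_zero (hcoeff j (hupper j.castSucc).2)
      chain_link := fun j => hcoeff j (hupper j.castSucc).2
      cycle_link := hcirc' }

theorem sum_simpleWeight (hp : p ∈ latticePaths m a b) (hτ : τ ∈ faces (koszul I b) (i + 1))
    (σ : Finset (Fin n)) [DecidablePred (IsFence 𝒞 i a b p σ τ)] :
    ∑ φ : FenceData m n with IsFence 𝒞 i a b p σ τ φ, simpleWeight 𝒞 i a b p σ τ φ =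
      circuitMap (𝒞 a) (pathWalk 𝒞 b p (rimMap (𝒞 b) (Pi.single τ 1))) σ := by
  rw [circuitMap_pathWalk]
  refine Finset.sum_bij_ne_zero (fun φ _ _ => φ.upper) (fun _ _ _ => Finset.mem_univ _)
    (fun φ hφ _ ψ hψ _ h => ?_) (fun u _ hu => ?_) fun φ hφ _ =>
      simpleWeight_eq_upperWeight hp (Finset.mem_filter.1 hφ).2
  · refine Prod.ext h (funext fun j => ?_)
    refine ((Finset.mem_filter.1 hφ).2.facet j).2.trans (Eq.trans ?_
      ((Finset.mem_filter.1 hψ).2.facet j).2.symm)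
    exact congrArg (fun u => Finset.erase (u j) (p j)) h
  · have hfence := isFence_of_upperWeight_ne_zero hp hτ hu
    exact ⟨_, Finset.mem_filter.2 ⟨Finset.mem_univ _, hfence⟩,
      by rwa [simpleWeight_eq_upperWeight hp hfence], rfl⟩

variable (𝒞)

theorem sylvanHom_single (hτ : τ ∈ faces (koszul I b) (i + 1)) :
    sylvanHom 𝒞 i a b (Pi.single τ 1) = circuitMap (𝒞 a)
      (∑ p ∈ latticePaths (b.degree - a.degree - 1) a b,
        pathWalk 𝒞 b p (rimMap (𝒞 b) (Pi.single τ 1))) := by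
  classical
  rw [sylvanHom, Fintype.linearCombination_apply_single, one_smul, map_sum]
  ext σ
  have h (y : Chain 𝕜 n) : (∑ σ, y σ • (Pi.single σ 1 : Chain 𝕜 n)) = y := (chain_eq_sum y).symm
  rw [h fun σ => sylvanEntry 𝒞 i a b σ τ, Finset.sum_apply]
  exact Finset.sum_congr rfl fun p hp => sum_simpleWeight hp hτ σ

theorem sylvanHom_eq {z : Chain 𝕜 n}
    (hz : z ∈ chains 𝕜 (koszul I b) (i + 1)) :
    sylvanHom 𝒞 i a b z = circuitMap (𝒞 a)
      (∑ p ∈ latticePaths (b.degree - a.degree - 1) a b, pathWalk 𝒞 b p (rimMap (𝒞 b) z)) := by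
  have h := eqOn_facesSpan (f := sylvanHom 𝒞 i a b) (g := circuitMap (𝒞 a) ∘ₗ
    (∑ p ∈ latticePaths (b.degree - a.degree - 1) a b, pathWalk 𝒞 b p) ∘ₗ rimMap (𝒞 b))
    (fun τ hτ => by
      rw [sylvanHom_single 𝒞 hτ, LinearMap.comp_apply, LinearMap.comp_apply, LinearMap.sum_apply])
    hz
  rwa [LinearMap.comp_apply, LinearMap.comp_apply, LinearMap.sum_apply] at h

theorem snoc_mem_latticePaths {v : Fin n} :
    (Fin.snoc p v : Fin (m + 2) → Fin n) ∈ latticePaths (m + 1) a b ↔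
      p ∈ latticePaths m (a + Finsupp.single v 1) b := by
  rw [mem_latticePaths, mem_latticePaths, Fin.sum_univ_castSucc]
  simp only [Fin.snoc_castSucc, Fin.snoc_last]
  rw [add_assoc, add_comm (Finsupp.single v 1)]

theorem pathWalk_snoc {v : Fin n} (hp : p ∈ latticePaths m (a + Finsupp.single v 1) b) :
    pathWalk 𝒞 b (Fin.snoc p v : Fin (m + 2) → Fin n) =
      removeVertex v ∘ₗ shrubMap (𝒞 (a + Finsupp.single v 1)) ∘ₗ pathWalk 𝒞 b p := by
  rw [pathWalk, walk_succ]
  simp only [Fin.snoc_castSucc, Fin.snoc_last, Fin.val_last, Fin.val_castSucc]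
  rw [node_snoc b p v le_rfl, node_last hp, pathWalk]
  congr 3
  funext j
  rw [node_snoc b p v (by omega)]

theorem descent_single (a b : Fin n →₀ ℕ) (y : Chain 𝕜 n) :
    descent 𝕜 n (Pi.single b y) a = ∑ p ∈ latticePaths 0 a b, pathWalk 𝒞 b p y := by
  rw [descent_apply, latticePaths, Finset.sum_filter]
  refine Fintype.sum_equiv (Equiv.funUnique (Fin 1) (Fin n)).symm _ _ fun v => ?_
  have hsum : a + ∑ _j : Fin (0 + 1), Finsupp.single v 1 = a + Finsupp.single v 1 := by simp
  simp only [pathWalk, walk, Equiv.funUnique_symm_apply, uniqueElim_const, hsum]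
  by_cases h : a + Finsupp.single v 1 = b
  · rw [if_pos h, h, Pi.single_eq_same]
  · rw [if_neg h, Pi.single_eq_of_ne h, map_zero]

theorem sum_pathWalk_succ (m : ℕ) (a b : Fin n →₀ ℕ) (y : Chain 𝕜 n) :
    ∑ p ∈ latticePaths (m + 1) a b, pathWalk 𝒞 b p y =
      ∑ v, removeVertex v (shrubMap (𝒞 (a + Finsupp.single v 1))
        (∑ p ∈ latticePaths m (a + Finsupp.single v 1) b, pathWalk 𝒞 b p y)) := by
  classical
  simp only [map_sum]
  rw [Finset.sum_sigma', eq_comm]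
  refine Finset.sum_bij (fun q _ => Fin.snoc q.2 q.1) (fun q hq => ?_) (fun q _ r _ h => ?_)
    (fun p hp => ?_) fun q hq => ?_
  · exact snoc_mem_latticePaths.2 (Finset.mem_sigma.1 hq).2
  · obtain ⟨h2, h1⟩ := Fin.snoc_inj.1 h
    exact Sigma.ext h1 (heq_of_eq h2)
  · have hsnoc := Fin.snoc_init_self p
    refine ⟨⟨p (Fin.last _), Fin.init p⟩, Finset.mem_sigma.2 ⟨Finset.mem_univ _, ?_⟩, hsnoc⟩
    rwa [← snoc_mem_latticePaths, hsnoc]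
  · rw [pathWalk_snoc 𝒞 (Finset.mem_sigma.1 hq).2]
    rfl

theorem descent_pow_single (m : ℕ) (a b : Fin n →₀ ℕ) (y : Chain 𝕜 n) :
    descent 𝕜 n (((levelShrub 𝒞 * descent 𝕜 n) ^ m) (Pi.single b y)) a =
      ∑ p ∈ latticePaths m a b, pathWalk 𝒞 b p y := by
  induction m generalizing a with
  | zero => exact descent_single 𝒞 a b y
  | succ m ih =>
    rw [pow_succ', Module.End.mul_apply, Module.End.mul_apply, descent_apply, sum_pathWalk_succ]
    simp only [levelShrub_apply, ih]

theorem descent_resolvent_single {c : Fin n →₀ ℕ} (a : Fin n →₀ ℕ) {b : Fin n →₀ ℕ} (hb : b ≤ c)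
    (y : Chain 𝕜 n) :
    descent 𝕜 n (resolvent 𝒞 c (Pi.single b y)) a =
      ∑ p ∈ latticePaths (b.degree - a.degree - 1) a b, pathWalk 𝒞 b p y := by
  rw [resolvent, LinearMap.sum_apply, map_sum, Finset.sum_apply]
  simp only [descent_pow_single]
  refine Finset.sum_eq_single_of_mem _ (Finset.mem_range.2 ?_) fun m _ hm => ?_
  · have := Finsupp.degree_mono hb
    omega
  · rw [Finset.sum_eq_zero]
    intro p hp
    have := degree_of_mem_latticePaths hp
    omega

theorem sylvanHom_eq_descent {c : Fin n →₀ ℕ} (hb : b ≤ c) {z : Chain 𝕜 n}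
    (hz : z ∈ chains 𝕜 (koszul I b) (i + 1)) :
    sylvanHom 𝒞 i a b z = circuitMap (𝒞 a)
      (descent 𝕜 n (resolvent 𝒞 c (Pi.single b (rimMap (𝒞 b) z))) a) := by
  rw [sylvanHom_eq 𝒞 hz, descent_resolvent_single 𝒞 a hb]

theorem inducesOnHomology (i : ℕ) (a b : Fin n →₀ ℕ) : InducesOnHomology 𝒞 i a b := by
  refine ⟨fun z hz => ?_, fun z hz => ?_⟩
  · rw [sylvanHom_eq_descent 𝒞 le_rfl hz.1]
    refine circuitMap_mem_cycles (descent_mem_strandPart (c := b) (resolvent_mem_strandPart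
      (single_mem_multispan le_rfl (rimMap_mem hz.1))) a).1
  · rw [sylvanHom_eq_descent 𝒞 le_rfl (boundaries_le_chains _ _ hz), rimMap_eq_zero hz]
    simp

end FenceSum

/-! ### Strands of the Sylvan modules -/

section Generators

variable {𝕜 : Type*} [Field 𝕜] {n : ℕ}

/-- The harmonic representative of a homology class, namely the hedge rim of any cycle
representing it; harmonic chains are the cycles killed by the shrub map. -/
noncomputable def harmonicRep {K : LowerSet (Finset (Fin n))} (𝒞 : Community 𝕜 K) (k : ℕ) :
    Homology 𝕜 K k →ₗ[𝕜] Chain 𝕜 n :=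
  Submodule.liftQ _ (rimMap 𝒞 ∘ₗ (cycles 𝕜 K k).subtype) fun _ hz => rimMap_eq_zero hz

section HarmonicRep

variable {K : LowerSet (Finset (Fin n))} {𝒞 : Community 𝕜 K} {k : ℕ}

theorem harmonicRep_mk (z : cycles 𝕜 K k) :
    harmonicRep 𝒞 k (Submodule.Quotient.mk z) = rimMap 𝒞 z := rfl

theorem harmonicRep_injective : Function.Injective (harmonicRep 𝒞 k) := by
  rw [← LinearMap.ker_eq_bot, LinearMap.ker_eq_bot']
  intro h hh
  obtain ⟨z, rfl⟩ := Submodule.Quotient.mk_surjective _ h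
  rw [harmonicRep_mk, rimMap_apply, sub_eq_zero] at hh
  rw [Submodule.Quotient.mk_eq_zero]
  change (z : Chain 𝕜 n) ∈ boundaries 𝕜 K k
  rw [hh]
  exact boundary_mem_boundaries (shrubMap_mem_chains z.2.1)

theorem harmonicRep_mem (h : Homology 𝕜 K k) : harmonicRep 𝒞 k h ∈ chains 𝕜 K k := by
  obtain ⟨z, rfl⟩ := Submodule.Quotient.mk_surjective _ h
  exact rimMap_mem z.2.1

theorem boundary_harmonicRep (h : Homology 𝕜 K k) : boundary 𝕜 (harmonicRep 𝒞 k h) = 0 := by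
  obtain ⟨z, rfl⟩ := Submodule.Quotient.mk_surjective _ h
  rw [harmonicRep_mk, rimMap_apply, map_sub, boundary_boundary, sub_zero]
  exact z.2.2

theorem shrubMap_harmonicRep (h : Homology 𝕜 K k) : shrubMap 𝒞 (harmonicRep 𝒞 k h) = 0 := by
  obtain ⟨z, rfl⟩ := Submodule.Quotient.mk_surjective _ h
  rw [harmonicRep_mk, rimMap_apply, map_sub, shrubMap_boundary_shrubMap z.2.1, sub_self]

theorem exists_harmonicRep_eq {z : Chain 𝕜 n} (hz : z ∈ cycles 𝕜 K k) (hs : shrubMap 𝒞 z = 0) :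
    ∃ h, harmonicRep 𝒞 k h = z :=
  ⟨Submodule.Quotient.mk ⟨z, hz⟩, by rw [harmonicRep_mk, rimMap_apply, hs, map_zero, sub_zero]⟩

end HarmonicRep

variable (I : Ideal (MvPolynomial (Fin n) 𝕜))

/-- The elements `x ^ e ⊗ h` of the summand indexed by `b`, which span the Sylvan module over the
ground field; they are homogeneous of degree `e + b`. -/
noncomputable def sylvanGen (i : ℕ) (b e : Fin n →₀ ℕ) :
    Homology 𝕜 (koszul I b) i →ₗ[𝕜] SylvanModule I i :=
  (DirectSum.lof (MvPolynomial (Fin n) 𝕜) (Fin n →₀ ℕ)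
      (fun b => MvPolynomial (Fin n) 𝕜 ⊗[𝕜] Homology 𝕜 (koszul I b) i) b).restrictScalars 𝕜 ∘ₗ
    TensorProduct.mk 𝕜 _ _ (MvPolynomial.monomial e 1)

variable {I}

theorem sylvanGen_apply (i : ℕ) (b e : Fin n →₀ ℕ) (h : Homology 𝕜 (koszul I b) i) :
    sylvanGen I i b e h = DirectSum.lof (MvPolynomial (Fin n) 𝕜) (Fin n →₀ ℕ)
      (fun b => MvPolynomial (Fin n) 𝕜 ⊗[𝕜] Homology 𝕜 (koszul I b) i) b
      (MvPolynomial.monomial e 1 ⊗ₜ h) := rfl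

theorem monomial_smul_sylvanGen (i : ℕ) (b e f : Fin n →₀ ℕ) (h : Homology 𝕜 (koszul I b) i) :
    MvPolynomial.monomial f (1 : 𝕜) • sylvanGen I i b e h = sylvanGen I i b (f + e) h := by
  rw [sylvanGen_apply, sylvanGen_apply, ← map_smul, TensorProduct.smul_tmul', smul_eq_mul,
    MvPolynomial.monomial_mul, one_mul]

theorem span_sylvanGen (i : ℕ) : Submodule.span 𝕜
    {x : SylvanModule I i | ∃ b e h, x = sylvanGen I i b e h} = ⊤ := by
  rw [eq_top_iff]
  rintro x -
  induction x using DirectSum.induction_on with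
  | zero => exact Submodule.zero_mem _
  | add x y hx hy => exact Submodule.add_mem _ hx hy
  | of b t =>
    induction t using TensorProduct.induction_on with
    | zero =>
      rw [map_zero]
      exact Submodule.zero_mem _
    | add x y hx hy =>
      rw [map_add]
      exact Submodule.add_mem _ hx hy
    | tmul f h =>
      induction f using MvPolynomial.induction_on' with
      | monomial e r =>
        refine Submodule.subset_span ⟨b, e, r • h, ?_⟩
        rw [sylvanGen_apply, ← TensorProduct.smul_tmul, MvPolynomial.smul_monomial, smul_eq_mul,
          mul_one]
        rfl
      | add p q hp hq =>
        rw [TensorProduct.add_tmul, map_add]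
        exact Submodule.add_mem _ hp hq

theorem sylvanModule_induction {i : ℕ} {P : SylvanModule I i → Prop}
    (gen : ∀ b e h, P (sylvanGen I i b e h)) (add : ∀ x y, P x → P y → P (x + y))
    (x : SylvanModule I i) : P x := by
  have hx : x ∈ Submodule.span 𝕜 {x : SylvanModule I i | ∃ b e h, x = sylvanGen I i b e h} :=
    by rw [span_sylvanGen]; exact Submodule.mem_top
  have h0 : P 0 := by
    have := gen 0 0 0
    rwa [map_zero (sylvanGen I i 0 0)] at this
  induction hx using Submodule.closure_induction with
  | zero => exact h0
  | add x y _ _ hx hy => exact add x y hx hy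
  | smul_mem r x hx =>
    obtain ⟨b, e, h, rfl⟩ := hx
    rw [← map_smul]
    exact gen b e _

variable (I) in
/-- The coefficient, a homology class, of `x ^ e` in the summand indexed by `b` of the Sylvan
module. -/
noncomputable def sylvanCoeff (i : ℕ) (b e : Fin n →₀ ℕ) :
    SylvanModule I i →ₗ[𝕜] Homology 𝕜 (koszul I b) i :=
  Finsupp.lapply e ∘ₗ
    (TensorProduct.equivFinsuppOfBasisLeft
      (MvPolynomial.basisMonomials (Fin n) 𝕜)).toLinearMap ∘ₗ
    DirectSum.component 𝕜 _ _ b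

theorem sylvanCoeff_sylvanGen_self (i : ℕ) (b e e' : Fin n →₀ ℕ)
    (h : Homology 𝕜 (koszul I b) i) :
    sylvanCoeff I i b e' (sylvanGen I i b e h) = if e = e' then h else 0 := by
  have hc : DirectSum.component 𝕜 (Fin n →₀ ℕ) _ b (sylvanGen I i b e h) =
      (MvPolynomial.monomial e (1 : 𝕜)) ⊗ₜ[𝕜] h := DirectSum.component.lof_self 𝕜 b _
  have he : MvPolynomial.monomial e (1 : 𝕜) = MvPolynomial.basisMonomials (Fin n) 𝕜 e := by simp
  rw [sylvanCoeff, LinearMap.comp_apply, LinearMap.comp_apply, hc, LinearEquiv.coe_coe,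
    TensorProduct.equivFinsuppOfBasisLeft_apply_tmul, he, Module.Basis.repr_self,
    Finsupp.lapply_apply, Finsupp.mapRange_apply, Finsupp.single_apply]
  split_ifs <;> simp

theorem sylvanCoeff_sylvanGen_ne (i : ℕ) {b b' : Fin n →₀ ℕ} (hb : b ≠ b') (e e' : Fin n →₀ ℕ)
    (h : Homology 𝕜 (koszul I b) i) : sylvanCoeff I i b' e' (sylvanGen I i b e h) = 0 := by
  have hc : DirectSum.component 𝕜 (Fin n →₀ ℕ) _ b' (sylvanGen I i b e h) = 0 :=
    DFinsupp.single_eq_of_ne hb.symm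
  rw [sylvanCoeff, LinearMap.comp_apply, LinearMap.comp_apply, hc, map_zero, map_zero]

theorem eq_zero_of_sylvanCoeff {i : ℕ} {x : SylvanModule I i}
    (h : ∀ b e, sylvanCoeff I i b e x = 0) : x = 0 := by
  refine DFinsupp.ext fun b => ?_
  refine (TensorProduct.equivFinsuppOfBasisLeft
    (MvPolynomial.basisMonomials (Fin n) 𝕜)).injective (Finsupp.ext fun e => ?_)
  refine (h b e).trans ?_
  rw [DFinsupp.zero_apply, map_zero, Finsupp.zero_apply]

end Generators

section StrandMap

variable {𝕜 : Type*} [Field 𝕜] {n : ℕ} {I : Ideal (MvPolynomial (Fin n) 𝕜)}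
  (𝒞 : ∀ b, Community 𝕜 (koszul I b))

/-- The component of degree `c` of an element of the Sylvan module, with each homology class
replaced by its harmonic representative; this identifies that component with the harmonic elements
of the strand of degree `c`. -/
noncomputable def strandMap (i : ℕ) (c : Fin n →₀ ℕ) : SylvanModule I i →ₗ[𝕜] Multichain 𝕜 n :=
  open Classical in
  LinearMap.pi fun b => if b ≤ c then harmonicRep (𝒞 b) i ∘ₗ sylvanCoeff I i b (c - b) else 0

variable {𝒞} {i : ℕ}

theorem strandMap_apply (c b : Fin n →₀ ℕ) (x : SylvanModule I i) [Decidable (b ≤ c)] :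
    strandMap 𝒞 i c x b = if b ≤ c then harmonicRep (𝒞 b) i (sylvanCoeff I i b (c - b) x)
      else 0 := by
  rw [strandMap, LinearMap.pi_apply]
  split_ifs <;> rfl

theorem strandMap_sylvanGen (c b e : Fin n →₀ ℕ) (h : Homology 𝕜 (koszul I b) i) :
    strandMap 𝒞 i c (sylvanGen I i b e h) =
      if e + b = c then Pi.single b (harmonicRep (𝒞 b) i h) else 0 := by
  classical
  funext b'
  rw [strandMap_apply]
  by_cases hb : b = b'
  · subst hb
    rw [sylvanCoeff_sylvanGen_self]
    by_cases hc : e + b = c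
    · subst hc
      simp
    · rw [if_neg hc]
      split_ifs with h1 h2
      · exact absurd (by rw [h2, tsub_add_cancel_of_le h1]) hc
      · rw [map_zero]; rfl
      · rfl
  · rw [sylvanCoeff_sylvanGen_ne i hb, map_zero, ite_self]
    split_ifs
    · rw [Pi.single_eq_of_ne (Ne.symm hb)]
    · rfl

theorem strandMap_mem (c : Fin n →₀ ℕ) (x : SylvanModule I i) :
    strandMap 𝒞 i c x ∈ strandPart I c i := by
  classical
  intro b
  rw [strandMap_apply]
  refine ⟨?_, fun h => if_neg h⟩
  split_ifs
  · exact harmonicRep_mem _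
  · exact Submodule.zero_mem _

theorem isHarmonic_strandMap (c : Fin n →₀ ℕ) (x : SylvanModule I i) :
    IsHarmonic 𝒞 (strandMap 𝒞 i c x) := by
  classical
  refine ⟨funext fun b => ?_, funext fun b => ?_⟩
  · rw [levelBoundary_apply, strandMap_apply]
    split_ifs
    · exact boundary_harmonicRep _
    · exact map_zero _
  · rw [levelShrub_apply, strandMap_apply]
    split_ifs
    · exact shrubMap_harmonicRep _
    · exact map_zero _

theorem eq_zero_of_strandMap {x : SylvanModule I i} (h : ∀ c, strandMap 𝒞 i c x = 0) : x = 0 := by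
  classical
  refine eq_zero_of_sylvanCoeff fun b e => harmonicRep_injective (𝒞 := 𝒞 b) ?_
  have := congrFun (h (e + b)) b
  rw [strandMap_apply, if_pos (self_le_add_left _ _), add_tsub_cancel_right] at this
  rw [this, map_zero]
  rfl

theorem eq_of_strandMap {x y : SylvanModule I i}
    (h : ∀ c, strandMap 𝒞 i c x = strandMap 𝒞 i c y) : x = y :=
  sub_eq_zero.1 (eq_zero_of_strandMap (𝒞 := 𝒞) fun c => by rw [map_sub, h, sub_self])

theorem exists_strandMap_support (x : SylvanModule I i) :
    ∃ s : Finset (Fin n →₀ ℕ), ∀ c ∉ s, strandMap 𝒞 i c x = 0 := by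
  classical
  induction x using sylvanModule_induction with
  | gen b e h =>
    refine ⟨{e + b}, fun c hc => ?_⟩
    rw [strandMap_sylvanGen, if_neg fun h => hc (by simp [h])]
  | add x y hx hy =>
    obtain ⟨s, hs⟩ := hx
    obtain ⟨t, ht⟩ := hy
    refine ⟨s ∪ t, fun c hc => ?_⟩
    rw [Finset.mem_union, not_or] at hc
    rw [map_add, hs c hc.1, ht c hc.2, add_zero]

theorem strandMap_sum_sylvanGen (c : Fin n →₀ ℕ) (u : ∀ b, Homology 𝕜 (koszul I b) i)
    {b : Fin n →₀ ℕ} (hb : b ≤ c) :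
    strandMap 𝒞 i c (∑ b ∈ Finset.Iic c, sylvanGen I i b (c - b) (u b)) b =
      harmonicRep (𝒞 b) i (u b) := by
  rw [map_sum, Finset.sum_apply, Finset.sum_eq_single_of_mem b (Finset.mem_Iic.2 hb)]
  · rw [strandMap_sylvanGen, if_pos (tsub_add_cancel_of_le hb), Pi.single_eq_same]
  · intro b' hb' hne
    rw [strandMap_sylvanGen, if_pos (tsub_add_cancel_of_le (Finset.mem_Iic.1 hb')),
      Pi.single_eq_of_ne hne.symm]

theorem strandMap_sum_sylvanGen_of_ne {c c' : Fin n →₀ ℕ} (hc : c' ≠ c)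
    (u : ∀ b, Homology 𝕜 (koszul I b) i) :
    strandMap 𝒞 i c' (∑ b ∈ Finset.Iic c, sylvanGen I i b (c - b) (u b)) = 0 := by
  rw [map_sum]
  refine Finset.sum_eq_zero fun b hb => ?_
  rw [strandMap_sylvanGen, tsub_add_cancel_of_le (Finset.mem_Iic.1 hb), if_neg hc.symm]

theorem exists_strandMap_eq {c : Fin n →₀ ℕ} {w : Multichain 𝕜 n} (hw : w ∈ strandPart I c i)
    (hh : IsHarmonic 𝒞 w) :
    ∃ x : SylvanModule I i, strandMap 𝒞 i c x = w ∧ ∀ c' ≠ c, strandMap 𝒞 i c' x = 0 := by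
  choose u hu using fun b =>
    exists_harmonicRep_eq (𝒞 := 𝒞 b) ⟨(hw b).1, congrFun hh.1 b⟩ (congrFun hh.2 b)
  refine ⟨∑ b ∈ Finset.Iic c, sylvanGen I i b (c - b) (u b), funext fun b => ?_,
    fun c' hc' => strandMap_sum_sylvanGen_of_ne hc' u⟩
  by_cases hb : b ≤ c
  · rw [strandMap_sum_sylvanGen c u hb, hu]
  · rw [(strandMap_mem c _ b).2 hb, (hw b).2 hb]

variable (h : ∀ a b : Fin n →₀ ℕ, a < b → ∀ i, InducesOnHomology 𝒞 i a b)

theorem sylvanDifferential_sylvanGen (b e : Fin n →₀ ℕ) (z : Homology 𝕜 (koszul I b) (i + 1)) :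
    sylvanDifferential 𝒞 h i (sylvanGen I (i + 1) b e z) =
      ∑ a ∈ (Finset.Iio b).attach, sylvanGen I i a.1 (b - a.1 + e)
        (sylvanHomology 𝒞 i a.1 b (h a.1 b (Finset.mem_Iio.1 a.2) i) z) := by
  rw [sylvanGen_apply, sylvanDifferential, DirectSum.toModule_lof, LinearMap.sum_apply]
  refine Finset.sum_congr rfl fun a _ => ?_
  rw [← monomial_smul_sylvanGen, sylvanGen_apply, LinearMap.comp_apply, LinearMap.smul_apply,
    LinearMap.baseChange_tmul, map_smul]

theorem harmonicRep_sylvanHomology {a b c : Fin n →₀ ℕ} (hb : b ≤ c)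
    (hab : InducesOnHomology 𝒞 i a b) (z : Homology 𝕜 (koszul I b) (i + 1)) :
    harmonicRep (𝒞 a) i (sylvanHomology 𝒞 i a b hab z) =
      transfer 𝒞 c (Pi.single b (harmonicRep (𝒞 b) (i + 1) z)) a := by
  obtain ⟨z, rfl⟩ := Submodule.Quotient.mk_surjective _ z
  have hs : (Pi.single b (rimMap (𝒞 b) z) : Multichain 𝕜 n) ∈ strandPart I c (i + 1) :=
    single_mem_multispan hb (rimMap_mem z.2.1)
  have hd := (descent_mem_strandPart (resolvent_mem_strandPart (𝒞 := 𝒞) hs) a).1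
  have h1 : harmonicRep (𝒞 a) i (sylvanHomology 𝒞 i a b hab (Submodule.Quotient.mk z)) =
      rimMap (𝒞 a) (sylvanHom 𝒞 i a b z) := rfl
  rw [h1, harmonicRep_mk, sylvanHom_eq_descent 𝒞 hb z.2.1, transfer_apply, harmonicProj_apply]
  generalize descent 𝕜 n (resolvent 𝒞 c (Pi.single b (rimMap (𝒞 b) z))) = y at hd
  have h2 : shrubMap (𝒞 a) (shrubMap (𝒞 a) (boundary 𝕜 (y a))) = 0 := by
    cases i with
    | zero => rw [boundary_eq_zero_of_mem_chains_zero hd, map_zero, map_zero]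
    | succ i => exact shrubMap_shrubMap (boundary_mem_chains hd)
  simp only [Pi.sub_apply, levelBoundary_apply, levelShrub_apply, rimMap_apply, circuitMap_apply,
    map_sub, h2, map_zero, sub_zero]

theorem transfer_single_eq_zero {a b c : Fin n →₀ ℕ} (hb : b ≤ c) (hab : ¬ a < b)
    (y : Chain 𝕜 n) : transfer 𝒞 c (Pi.single b y) a = 0 := by
  have h0 : descent 𝕜 n (resolvent 𝒞 c (Pi.single b y)) a = 0 := by
    rw [descent_resolvent_single 𝒞 a hb]
    refine Finset.sum_eq_zero fun p hp => absurd (lt_of_le_of_ne (le_of_mem_latticePaths hp) ?_) hab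
    rintro rfl
    have := degree_of_mem_latticePaths hp
    omega
  rw [transfer_apply, harmonicProj_apply]
  simp [levelBoundary_apply, levelShrub_apply, h0]

theorem strandMap_sylvanDifferential (c : Fin n →₀ ℕ) (x : SylvanModule I (i + 1)) :
    strandMap 𝒞 i c (sylvanDifferential 𝒞 h i x) = transfer 𝒞 c (strandMap 𝒞 (i + 1) c x) := by
  induction x using sylvanModule_induction with
  | add x y hx hy => rw [map_add, map_add, map_add, map_add, hx, hy]
  | gen b e z =>
    rw [sylvanDifferential_sylvanGen, map_sum, strandMap_sylvanGen]
    have hc (a : Finset.Iio b) : b - a.1 + e + a.1 = e + b := by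
      rw [add_right_comm, tsub_add_cancel_of_le (Finset.mem_Iio.1 a.2).le, add_comm]
    simp only [strandMap_sylvanGen, hc]
    by_cases hcb : e + b = c
    swap
    · simp [hcb]
    have hb : b ≤ c := hcb ▸ self_le_add_left _ _
    simp only [if_pos hcb]
    funext a
    rw [Finset.sum_apply]
    by_cases ha : a < b
    · rw [Finset.sum_eq_single_of_mem ⟨a, Finset.mem_Iio.2 ha⟩ (Finset.mem_attach _ _),
        Pi.single_eq_same, harmonicRep_sylvanHomology hb]
      intro a' _ ha'
      exact Pi.single_eq_of_ne (fun h' => ha' (Subtype.ext h'.symm)) _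
    · rw [transfer_single_eq_zero hb ha]
      refine Finset.sum_eq_zero fun a' _ => Pi.single_eq_of_ne ?_ _
      rintro rfl
      exact ha (Finset.mem_Iio.1 a'.2)

theorem mem_range_sylvanDifferential {y : SylvanModule I i}
    (hy : ∀ c, ∃ w ∈ strandPart I c (i + 1), IsHarmonic 𝒞 w ∧
      transfer 𝒞 c w = strandMap 𝒞 i c y) : y ∈ Set.range (sylvanDifferential 𝒞 h i) := by
  obtain ⟨s, hs⟩ := exists_strandMap_support (𝒞 := 𝒞) y
  choose w hw hwh hwy using hy
  choose u hu hu' using fun c => exists_strandMap_eq (hw c) (hwh c)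
  refine ⟨∑ c ∈ s, u c, eq_of_strandMap (𝒞 := 𝒞) fun c => ?_⟩
  rw [strandMap_sylvanDifferential, map_sum]
  by_cases hc : c ∈ s
  · rw [Finset.sum_eq_single_of_mem c hc fun c' _ hc' => hu' c' c hc'.symm, hu, hwy]
  · rw [Finset.sum_eq_zero fun c' hc' => hu' c' c fun h' => hc (h' ▸ hc'), hs c hc, map_zero]

theorem sylvanDifferential_exact (i : ℕ) :
    Function.Exact (sylvanDifferential 𝒞 h (i + 1)) (sylvanDifferential 𝒞 h i) := by
  intro y
  constructor
  · intro hy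
    refine mem_range_sylvanDifferential h fun c => ?_
    refine transfer_exact (strandMap_mem c y) (isHarmonic_strandMap c y) ?_ fun hi => by omega
    rw [← strandMap_sylvanDifferential h, hy, map_zero]
  · rintro ⟨x, rfl⟩
    refine eq_zero_of_strandMap (𝒞 := 𝒞) fun c => ?_
    rw [strandMap_sylvanDifferential, strandMap_sylvanDifferential,
      transfer_transfer (strandPart_le_strand _ (strandMap_mem c x)) (isHarmonic_strandMap c x)]

theorem sylvanDifferential_mem_sylvanPiece (c : Fin n →₀ ℕ) {x : SylvanModule I (i + 1)}
    (hx : x ∈ sylvanPiece I (i + 1) c) : sylvanDifferential 𝒞 h i x ∈ sylvanPiece I i c := by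
  suffices sylvanPiece I (i + 1) c ≤
      (sylvanPiece I i c).comap ((sylvanDifferential 𝒞 h i).restrictScalars 𝕜) from this hx
  refine Submodule.span_le.2 ?_
  rintro _ ⟨e, b, z, hc, rfl⟩
  change sylvanDifferential 𝒞 h i (sylvanGen I (i + 1) b e z) ∈ sylvanPiece I i c
  rw [sylvanDifferential_sylvanGen]
  refine Submodule.sum_mem _ fun a _ => Submodule.subset_span ⟨_, a.1, _, ?_, rfl⟩
  rw [add_right_comm, tsub_add_cancel_of_le (Finset.mem_Iio.1 a.2).le, add_comm, hc]

theorem range_sylvanDifferential_le (i : ℕ) : LinearMap.range (sylvanDifferential 𝒞 h i) ≤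
    Ideal.span (Set.range (MvPolynomial.X : Fin n → MvPolynomial (Fin n) 𝕜)) •
      (⊤ : Submodule (MvPolynomial (Fin n) 𝕜) (SylvanModule I i)) := by
  rintro _ ⟨x, rfl⟩
  induction x using sylvanModule_induction with
  | add x y hx hy =>
    rw [map_add]
    exact Submodule.add_mem _ hx hy
  | gen b e z =>
    rw [sylvanDifferential_sylvanGen]
    refine Submodule.sum_mem _ fun a _ => ?_
    rw [← monomial_smul_sylvanGen]
    have hdeg : 1 ≤ (b - a.1).degree := by
      rw [Nat.one_le_iff_ne_zero, Ne, Finsupp.degree_eq_zero_iff, tsub_eq_zero_iff_le]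
      exact (Finset.mem_Iio.1 a.2).not_ge
    have hmem := (MvPolynomial.monomial_mem_pow_idealOfVars_iff 1 _ (one_ne_zero (α := 𝕜))).2 hdeg
    rw [pow_one] at hmem
    exact Submodule.smul_mem_smul hmem Submodule.mem_top

end StrandMap

/-! ### The augmentation -/

section Augmentation

variable {𝕜 : Type*} [Field 𝕜] {n : ℕ} {I : Ideal (MvPolynomial (Fin n) 𝕜)}
  (𝒞 : ∀ b, Community 𝕜 (koszul I b))

/-- The augmentation of the Sylvan resolution, with values in the polynomial ring: it sends
`x ^ e ⊗ h` in the summand indexed by `b` to `x ^ (e + b)` times the coefficient of the empty face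
in the harmonic representative of `h`. -/
noncomputable def augmentation :
    SylvanModule I 0 →ₗ[MvPolynomial (Fin n) 𝕜] MvPolynomial (Fin n) 𝕜 :=
  DirectSum.toModule (MvPolynomial (Fin n) 𝕜) (Fin n →₀ ℕ) (MvPolynomial (Fin n) 𝕜) fun b =>
    MvPolynomial.monomial b (1 : 𝕜) •
      ((TensorProduct.AlgebraTensorModule.rid 𝕜 (MvPolynomial (Fin n) 𝕜)
        (MvPolynomial (Fin n) 𝕜)).toLinearMap ∘ₗ
      (LinearMap.proj ∅ ∘ₗ harmonicRep (𝒞 b) 0).baseChange (MvPolynomial (Fin n) 𝕜))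

variable {𝒞}

theorem augmentation_sylvanGen (b e : Fin n →₀ ℕ) (h : Homology 𝕜 (koszul I b) 0) :
    augmentation 𝒞 (sylvanGen I 0 b e h) =
      MvPolynomial.monomial (e + b) (harmonicRep (𝒞 b) 0 h ∅) := by
  rw [augmentation, sylvanGen_apply, DirectSum.toModule_lof, LinearMap.smul_apply,
    LinearMap.comp_apply, LinearMap.baseChange_tmul, LinearEquiv.coe_coe,
    TensorProduct.AlgebraTensorModule.rid_tmul, LinearMap.comp_apply, LinearMap.proj_apply,
    MvPolynomial.smul_monomial, smul_eq_mul, smul_eq_mul, mul_one, MvPolynomial.monomial_mul,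
    one_mul, add_comm]

theorem coeff_augmentation (c : Fin n →₀ ℕ) (x : SylvanModule I 0) :
    MvPolynomial.coeff c (augmentation 𝒞 x) = strandAugmentation 𝕜 c (strandMap 𝒞 0 c x) := by
  classical
  induction x using sylvanModule_induction with
  | add x y hx hy => rw [map_add, map_add, map_add, MvPolynomial.coeff_add, hx, hy]
  | gen b e h =>
    rw [augmentation_sylvanGen, MvPolynomial.coeff_monomial, strandMap_sylvanGen]
    split_ifs with hc
    · rw [strandAugmentation_apply, Finset.sum_eq_single_of_mem b
        (Finset.mem_Iic.2 (hc ▸ self_le_add_left _ _)), Pi.single_eq_same]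
      intro b' _ hb'
      rw [Pi.single_eq_of_ne hb', Pi.zero_apply]
    · rw [map_zero]

theorem empty_mem_koszul {b : Fin n →₀ ℕ} :
    ∅ ∈ koszul I b ↔ MvPolynomial.monomial b (1 : 𝕜) ∈ I := by
  simp [mem_koszul, charVec]

theorem augmentation_mem (x : SylvanModule I 0) : augmentation 𝒞 x ∈ I := by
  induction x using sylvanModule_induction with
  | add x y hx hy =>
    rw [map_add]
    exact I.add_mem hx hy
  | gen b e h =>
    rw [augmentation_sylvanGen]
    by_cases hb : MvPolynomial.monomial b (1 : 𝕜) ∈ I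
    · rw [← mul_one (harmonicRep (𝒞 b) 0 h ∅), ← MvPolynomial.monomial_mul]
      exact I.mul_mem_left _ hb
    · rw [harmonicRep_mem h ∅ fun h' => hb (empty_mem_koszul.1 h'.1), map_zero]
      exact I.zero_mem

theorem monomial_mem_range_augmentation_of_forall_notMem {b : Fin n →₀ ℕ}
    (hb : MvPolynomial.monomial b (1 : 𝕜) ∈ I) (hv : ∀ v, {v} ∉ koszul I b) :
    MvPolynomial.monomial b (1 : 𝕜) ∈ LinearMap.range (augmentation 𝒞) := by
  have hz : (Pi.single ∅ 1 : Chain 𝕜 n) ∈ chains 𝕜 (koszul I b) 0 :=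
    single_mem_facesSpan ⟨empty_mem_koszul.2 hb, rfl⟩
  have hs : shrubMap (𝒞 b) (Pi.single ∅ 1) = 0 := by
    funext τ
    refine shrubMap_mem_chains hz τ fun hτ => ?_
    obtain ⟨v, rfl⟩ := Finset.card_eq_one.1 hτ.2
    exact hv v hτ.1
  obtain ⟨h, hh⟩ := exists_harmonicRep_eq ⟨hz, boundary_eq_zero_of_mem_chains_zero hz⟩ hs
  exact ⟨sylvanGen I 0 b 0 h, by rw [augmentation_sylvanGen, hh, Pi.single_eq_same, zero_add]⟩

theorem monomial_mem_range_augmentation (b : Fin n →₀ ℕ)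
    (hb : MvPolynomial.monomial b (1 : 𝕜) ∈ I) :
    MvPolynomial.monomial b (1 : 𝕜) ∈ LinearMap.range (augmentation 𝒞) := by
  induction b using WellFoundedLT.induction with
  | ind b ih =>
    by_cases h : ∃ v, {v} ∈ koszul I b
    swap
    · exact monomial_mem_range_augmentation_of_forall_notMem hb (not_exists.1 h)
    obtain ⟨v, hv⟩ := h
    rw [mem_koszul, charVec, Finset.sum_singleton] at hv
    obtain ⟨hle, hI⟩ := hv
    have hlt : b - Finsupp.single v 1 < b := by
      refine lt_of_le_of_ne tsub_le_self fun h => ?_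
      have hdeg := congrArg Finsupp.degree (tsub_add_cancel_of_le hle)
      rw [h, map_add, Finsupp.degree_single] at hdeg
      omega
    have := Submodule.smul_mem _ (MvPolynomial.X v) (ih _ hlt hI)
    rwa [MvPolynomial.X, smul_eq_mul, MvPolynomial.monomial_mul, one_mul,
      add_tsub_cancel_of_le hle] at this

theorem range_augmentation (hI : IsMonomialIdeal I) : LinearMap.range (augmentation 𝒞) = I := by
  refine le_antisymm ?_ ?_
  · rintro _ ⟨x, rfl⟩
    exact augmentation_mem x
  · obtain ⟨A, hA⟩ := hI
    conv_lhs => rw [hA]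
    refine Ideal.span_le.2 ?_
    rintro _ ⟨e, he, rfl⟩
    exact monomial_mem_range_augmentation e (hA ▸ Ideal.subset_span ⟨e, he, rfl⟩)

theorem exact_sylvanDifferential_augmentation
    (h : ∀ a b : Fin n →₀ ℕ, a < b → ∀ i, InducesOnHomology 𝒞 i a b) :
    Function.Exact (sylvanDifferential 𝒞 h 0) (augmentation 𝒞) := by
  intro y
  constructor
  · intro hy
    refine mem_range_sylvanDifferential h fun c => ?_
    have hm := strandMap_mem (𝒞 := 𝒞) c y
    refine transfer_exact hm (isHarmonic_strandMap c y) ?_ fun _ => ?_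
    · rw [transfer_apply, resolvent_of_mem_strandPart_zero hm, descent_eq_zero hm, map_zero]
    · rw [← coeff_augmentation, hy, MvPolynomial.coeff_zero]
  · rintro ⟨x, rfl⟩
    refine MvPolynomial.ext _ _ fun c => ?_
    rw [coeff_augmentation, strandMap_sylvanDifferential,
      strandAugmentation_transfer (strandMap_mem c x) (isHarmonic_strandMap c x),
      MvPolynomial.coeff_zero]

theorem exists_augmentation_eq_monomial {c : Fin n →₀ ℕ} {x : SylvanModule I 0}
    (hx : x ∈ sylvanPiece I 0 c) : ∃ t : 𝕜, augmentation 𝒞 x = MvPolynomial.monomial c t := by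
  suffices sylvanPiece I 0 c ≤ (LinearMap.range (MvPolynomial.monomial (R := 𝕜) c)).comap
      ((augmentation 𝒞).restrictScalars 𝕜) by
    obtain ⟨t, ht⟩ := this hx
    exact ⟨t, ht.symm⟩
  refine Submodule.span_le.2 ?_
  rintro _ ⟨e, b, z, rfl, rfl⟩
  exact ⟨_, (augmentation_sylvanGen b e z).symm⟩

theorem exists_augmentation (hI : IsMonomialIdeal I)
    (h : ∀ a b : Fin n →₀ ℕ, a < b → ∀ i, InducesOnHomology 𝒞 i a b) :
    ∃ ε : SylvanModule I 0 →ₗ[MvPolynomial (Fin n) 𝕜] I,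
      Function.Surjective ε ∧ Function.Exact (sylvanDifferential 𝒞 h 0) ε ∧
        ∀ c, ∀ x ∈ sylvanPiece I 0 c,
          ∃ t : 𝕜, (ε x : MvPolynomial (Fin n) 𝕜) = MvPolynomial.monomial c t := by
  refine ⟨(augmentation 𝒞).codRestrict I augmentation_mem, fun f => ?_, fun y => ?_,
    fun c x hx => exists_augmentation_eq_monomial hx⟩
  · obtain ⟨x, hx⟩ : f.1 ∈ LinearMap.range (augmentation 𝒞) := by
      rw [range_augmentation hI]
      exact f.2
    exact ⟨x, Subtype.ext hx⟩
  · rw [← exact_sylvanDifferential_augmentation h y, Subtype.ext_iff]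
    rfl

end Augmentation

/-! ### Finite graded bases -/

section Finiteness

variable {𝕜 : Type*} [Field 𝕜] {n : ℕ} {I : Ideal (MvPolynomial (Fin n) 𝕜)}

theorem charVec_apply (τ : Finset (Fin n)) (v : Fin n) :
    charVec τ v = if v ∈ τ then 1 else 0 := by
  simp [charVec, Finsupp.finsetSum_apply, Finsupp.single_apply]

theorem subsingleton_homology_of_cone {K : LowerSet (Finset (Fin n))} {v : Fin n}
    (hv : ∀ τ ∈ K, insert v τ ∈ K) (k : ℕ) : Subsingleton (Homology 𝕜 K k) := by
  rw [Submodule.Quotient.subsingleton_iff, eq_top_iff]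
  rintro ⟨z, hz, hbz⟩ -
  refine ⟨addVertex v z, fun τ hτ => ?_, ?_⟩
  · rw [addVertex_apply]
    split_ifs with h
    · rw [hz, mul_zero]
      refine fun h' => hτ ⟨?_, ?_⟩
      · have := hv _ h'.1
        rwa [Finset.insert_erase h] at this
      · rw [← h'.2, Finset.card_erase_add_one h]
    · rfl
  · have h1 : boundary 𝕜 (addVertex v z) + addVertex v (boundary 𝕜 z) = z := by
      rw [boundary_apply_eq_sum, boundary_apply_eq_sum, map_sum, ← Finset.sum_add_distrib,
        Finset.sum_eq_single v (fun w _ hw => removeVertex_addVertex hw z) (by simp)]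
      funext σ
      rw [Pi.add_apply, removeVertex_addVertex_self, addVertex_removeVertex_self]
      split_ifs <;> simp
    rw [LinearMap.mem_ker.1 hbz, map_zero, add_zero] at h1
    exact h1

theorem IsMonomialIdeal.exists_finset_monomial_mem_iff (hI : IsMonomialIdeal I) :
    ∃ s : Finset (Fin n →₀ ℕ), ∀ u, MvPolynomial.monomial u (1 : 𝕜) ∈ I ↔ ∃ g ∈ s, g ≤ u := by
  classical
  obtain ⟨A, hA⟩ := hI
  obtain ⟨t, ht, hspan⟩ := (Submodule.fg_span_iff_fg_span_finset_subset _).1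
    (IsNoetherian.noetherian (Ideal.span
      ((fun e => MvPolynomial.monomial e (1 : 𝕜)) '' A)))
  obtain ⟨s, -, rfl⟩ := Finset.subset_set_image_iff.1 ht
  have hI : I = Ideal.span ((fun e => MvPolynomial.monomial e (1 : 𝕜)) '' s) := by
    rw [hA, ← Finset.coe_image]
    exact hspan
  refine ⟨s, fun u => ?_⟩
  rw [hI, MvPolynomial.mem_ideal_span_monomial_image, MvPolynomial.support_monomial,
    if_neg one_ne_zero]
  simp

theorem insert_mem_koszul {s : Finset (Fin n →₀ ℕ)}
    (hs : ∀ u, MvPolynomial.monomial u (1 : 𝕜) ∈ I ↔ ∃ g ∈ s, g ≤ u) {b : Fin n →₀ ℕ} {v : Fin n}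
    (hv : ∀ g ∈ s, g v < b v) {τ : Finset (Fin n)} (hτ : τ ∈ koszul I b) :
    insert v τ ∈ koszul I b := by
  by_cases hvτ : v ∈ τ
  · rwa [Finset.insert_eq_of_mem hvτ]
  rw [mem_koszul, hs] at hτ ⊢
  obtain ⟨hle, g, hg, hgb⟩ := hτ
  have hgv := hv g hg
  refine ⟨fun w => ?_, g, hg, fun w => ?_⟩
  · have := hle w
    rw [charVec_apply] at this ⊢
    rcases eq_or_ne w v with rfl | hw
    · rw [if_pos (Finset.mem_insert_self w τ)]
      omega
    · simpa [hw] using this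
  · have := hgb w
    rw [Finsupp.tsub_apply, charVec_apply] at this ⊢
    rcases eq_or_ne w v with rfl | hw
    · rw [if_pos (Finset.mem_insert_self w τ)]
      omega
    · simpa [hw] using this

theorem exists_finset_homology_subsingleton (hI : IsMonomialIdeal I) :
    ∃ s : Finset (Fin n →₀ ℕ), ∀ b ∉ s, ∀ k, Subsingleton (Homology 𝕜 (koszul I b) k) := by
  classical
  obtain ⟨s, hs⟩ := hI.exists_finset_monomial_mem_iff
  refine ⟨Finset.Iic (s.sup id), fun b hb k => ?_⟩
  obtain ⟨v, hv⟩ : ∃ v, s.sup id v < b v := by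
    by_contra! h
    exact hb (Finset.mem_Iic.2 h)
  have hgv (g) (hg : g ∈ s) : g v < b v := lt_of_le_of_lt (Finset.le_sup (f := id) hg v) hv
  exact subsingleton_homology_of_cone (fun τ hτ => insert_mem_koszul hs hgv hτ) k

theorem dfinsupp_basis_apply {ι R : Type*} {M : ι → Type*} {η : ι → Type*} [DecidableEq ι]
    [Semiring R] [∀ i, AddCommMonoid (M i)] [∀ i, Module R (M i)]
    (b : ∀ i, Module.Basis (η i) R (M i)) (q : Σ i, η i) :
    DFinsupp.basis b q = DFinsupp.single q.1 (b q.1 q.2) := by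
  classical
  refine (DFinsupp.basis b).repr.injective ?_
  rw [Module.Basis.repr_self, DFinsupp.basis]
  change _ = (sigmaFinsuppLequivDFinsupp R).symm
    (DFinsupp.mapRange.linearEquiv (fun i => (b i).repr) (DFinsupp.single q.1 (b q.1 q.2)))
  rw [LinearEquiv.eq_symm_apply, DFinsupp.mapRange.linearEquiv_apply, DFinsupp.mapRange_single,
    Module.Basis.repr_self]
  exact sigmaFinsuppEquivDFinsupp_single q 1

variable (I) in
/-- The degrees `b` of the Koszul complexes together with the elements of a basis of their
homology, indexing a basis of the Sylvan module. -/
abbrev SylvanIndex (i : ℕ) : Type :=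
  Σ b : Fin n →₀ ℕ, Fin (Module.finrank 𝕜 (Homology 𝕜 (koszul I b) i))

theorem finite_sylvanIndex (hI : IsMonomialIdeal I) (i : ℕ) : Finite (SylvanIndex I i) := by
  obtain ⟨s, hs⟩ := exists_finset_homology_subsingleton hI
  have hmem (q : SylvanIndex I i) : q.1 ∈ s := by
    by_contra h
    have := hs q.1 h i
    have h0 : Module.finrank 𝕜 (Homology 𝕜 (koszul I q.1) i) = 0 :=
      Module.finrank_zero_of_subsingleton
    exact (Fin.cast h0 q.2).elim0
  refine Finite.of_injective
    (β := Σ b : s, Fin (Module.finrank 𝕜 (Homology 𝕜 (koszul I b.1) i)))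
    (fun q => ⟨⟨q.1, hmem q⟩, q.2⟩) ?_
  rintro ⟨b, j⟩ ⟨b', j'⟩ h
  simpa using h

variable (I) in
/-- The basis of the Sylvan module consisting of the elements `1 ⊗ h`, with `h` in a basis of the
homology of the Koszul complex in degree `b`. -/
noncomputable def sylvanBasis (i : ℕ) :
    Module.Basis (SylvanIndex I i) (MvPolynomial (Fin n) 𝕜) (SylvanModule I i) :=
  DFinsupp.basis fun _ => Algebra.TensorProduct.basis _ (Module.finBasis 𝕜 _)

theorem monomial_smul_sylvanBasis {i : ℕ} (e : Fin n →₀ ℕ) (q : SylvanIndex I i) :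
    MvPolynomial.monomial e (1 : 𝕜) • sylvanBasis I i q =
      sylvanGen I i q.1 e (Module.finBasis 𝕜 _ q.2) := by
  have : sylvanBasis I i q = sylvanGen I i q.1 0 (Module.finBasis 𝕜 _ q.2) := by
    rw [sylvanBasis, dfinsupp_basis_apply, Algebra.TensorProduct.basis_apply]
    rfl
  rw [this, monomial_smul_sylvanGen, add_zero]

theorem sylvanPiece_eq_span_sylvanBasis (i : ℕ) (c : Fin n →₀ ℕ) :
    sylvanPiece I i c = Submodule.span 𝕜 {x | ∃ (e : Fin n →₀ ℕ) (q : SylvanIndex I i),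
      e + q.1 = c ∧ x = MvPolynomial.monomial e (1 : 𝕜) • sylvanBasis I i q} := by
  refine le_antisymm (Submodule.span_le.2 ?_) (Submodule.span_mono ?_)
  · rintro _ ⟨e, b, h, hc, rfl⟩
    rw [← sylvanGen_apply]
    have hmem := Submodule.mem_map_of_mem (f := sylvanGen I i b e)
      ((Module.finBasis 𝕜 (Homology 𝕜 (koszul I b) i)).mem_span h)
    rw [Submodule.map_span] at hmem
    refine Submodule.span_mono ?_ hmem
    rintro _ ⟨_, ⟨j, rfl⟩, rfl⟩
    exact ⟨e, ⟨b, j⟩, hc, (monomial_smul_sylvanBasis e ⟨b, j⟩).symm⟩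
  · rintro _ ⟨e, q, hc, rfl⟩
    exact ⟨e, q.1, _, hc, monomial_smul_sylvanBasis e q⟩

theorem exists_graded_basis (hI : IsMonomialIdeal I) (i : ℕ) :
    ∃ (r : ℕ) (B : Module.Basis (Fin r) (MvPolynomial (Fin n) 𝕜) (SylvanModule I i))
      (deg : Fin r → (Fin n →₀ ℕ)), ∀ c, sylvanPiece I i c = Submodule.span 𝕜
        {x | ∃ (e : Fin n →₀ ℕ) (j : Fin r), e + deg j = c ∧
          x = MvPolynomial.monomial e (1 : 𝕜) • B j} := by
  have := finite_sylvanIndex hI i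
  let e₀ := Finite.equivFin (SylvanIndex I i)
  refine ⟨_, (sylvanBasis I i).reindex e₀, fun j => (e₀.symm j).1, fun c => ?_⟩
  rw [sylvanPiece_eq_span_sylvanBasis]
  simp only [Module.Basis.reindex_apply]
  exact congrArg _ (Set.ext fun x => exists_congr fun e => e₀.exists_congr_left)

end Finiteness

end Sylvan

theorem corollary8p6 {𝕜 : Type*} [Field 𝕜] {n : ℕ} (I : Ideal (MvPolynomial (Fin n) 𝕜))
    (hI : Sylvan.IsMonomialIdeal I)
    (𝒞 : ∀ b : Fin n →₀ ℕ, Sylvan.Community 𝕜 (Sylvan.koszul I b)) :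
    ∃ h : ∀ a b : Fin n →₀ ℕ, a < b → ∀ i, Sylvan.InducesOnHomology 𝒞 i a b,
      Sylvan.IsMinimalFreeResolution I (Sylvan.SylvanModule I) (Sylvan.sylvanPiece I)
        (Sylvan.sylvanDifferential 𝒞 h) := by
  have h (a b : Fin n →₀ ℕ) (_ : a < b) (i : ℕ) := Sylvan.inducesOnHomology 𝒞 i a b
  exact ⟨h,
    { graded_free := Sylvan.exists_graded_basis hI
      homogeneous := fun _ c _ hx => Sylvan.sylvanDifferential_mem_sylvanPiece h c hx
      exact := Sylvan.sylvanDifferential_exact h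
      augmentation := Sylvan.exists_augmentation hI h
      minimal := Sylvan.range_sylvanDifferential_le h }⟩
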